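/- Let $\mathbb{Z}\subset\mathbb{R}^l$ be compact and convex, let $k:\mathbb{Z}\times\mathbb{Z}\to\mathbb{R}$ be a measurable (for example continuous) symmetric positive semi-definite kernel with reproducing kernel Hilbert space $\mathcal{R}(k)$, and let $B,R,\epsilon>0$ and $\delta\in(0,1]$. Let $J\in\mathcal{R}(k)$ satisfy $\|J\|_{\mathcal{R}(k)}\le B$ and attain its maximum $J^*=\max_{z\in\mathbb{Z}}J(z)$. A measurement at $z_i$ returns $y_i=J(z_i)+\xi_i$, $i=0,1,2,\dots$, where the noise is conditionally $R$-sub-Gaussian: there is a filtration $(\mathcal{F}_i)_{i\ge0}$ such that $z_i$ is $\mathcal{F}_i$-measurable, $\xi_i$ is $\mathcal{F}_{i+1}$-measurable, and $\mathbb{E}[e^{t\xi_i}\mid\mathcal{F}_i]\le e^{R^2t^2/2}$ almost surely for all $t\in\mathbb{R}$. The modified GP-UCB algorithm starts from one sample $(z_0,y_0)$. At iteration $i=1,2,\dots$ the data are $\mathbb{D}_{i-1}=\{(z_j,y_j)\}_{j=0}^{i-1}$; write $K_i=(k(z_a,z_b))_{0\le a,b\le i-1}$, $y_{0:i-1}=(y_0,\dots,y_{i-1})^T$,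 $\kappa(z)=(k(z,z_0),\dots,k(z,z_{i-1}))^T$, and $$\mu_{i-1}(z)=\kappa(z)^T(K_i+\lambda_iI)^{-1}y_{0:i-1},\qquad \sigma_{i-1}(z)^2=k(z,z)-\kappa(z)^T(K_i+\lambda_iI)^{-1}\kappa(z),$$ $$\beta_i=B+R\sqrt{2\ln\frac{\sqrt{\det\left((1+\frac2i)I+K_i\right)}}{\delta}}.$$ Here the regularization parameters form any bounded sequence with $\lambda_i\ge1$ (for instance $\lambda_i=1+\frac2i$, or a constant). The algorithm picks $z_i\in\arg\max_{z\in\mathbb{Z}}\left(\mu_{i-1}(z)+\beta_i\sigma_{i-1}(z)\right)$ and measures $y_i$. If $F_i:=2\beta_i\sigma_{i-1}(z_i)\le\epsilon$, it terminates at $i^*=i$ with output $J^e=\mu_{i^*-1}(z_{i^*})+\beta_{i^*}\sigma_{i^*-1}(z_{i^*})$; otherwise it proceeds to iteration $i+1$. 1. (Termination) For $s>0$ let $\gamma_j$ be the supremum, over $j$-tuples $A=(a_1,\dots,a_j)$ of points of $\mathbb{Z}$, of the mutual information $I(y_A;f_A)=\frac12\ln\det\left(I+s^{-1}(k(a_p,a_q))_{p,q}\right)$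 between $f_A\sim\mathcal{N}(0,(k(a_p,a_q))_{p,q})$ and $y_A=f_A+\mathcal{N}(0,sI)$ with independent noise. If, for some $s>0$, $\gamma_j=O(j^p\log j)$ as $j\to\infty$ with some $p<\frac12$, then every run of the algorithm terminates after finitely many iterations. 2. (Accuracy) With probability at least $1-\delta$ over the noise, $J^*\le J^e$ at termination; and with probability at least $1-\delta$, $|J^*-J^e|\le\epsilon$ at termination. Without the growth condition of part 1 this still holds, in the sense that the event that the algorithm terminates with an output violating the respective inequality has probability at most $\delta$. -/

import Mathlib

open MeasureTheory Filter

noncomputable section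

namespace GPUCB

variable {X : Type*}

/-- The kernel matrix `K = (k (x a) (x b))` of the sample points `x`. -/
def gram (k : X → X → ℝ) {n : ℕ} (x : Fin n → X) : Matrix (Fin n) (Fin n) ℝ :=
  Matrix.of fun a b => k (x a) (x b)

/-- The covariance vector `(k (u, x a))` of `u` with the sample points. -/
def kvec (k : X → X → ℝ) {n : ℕ} (x : Fin n → X) (u : X) : Fin n → ℝ :=
  fun a => k u (x a)

/-- Posterior mean of Gaussian process regression from the samples `(x a, y a)`, with
regularization `lam`. -/
def postMean (k : X → X → ℝ) (lam : ℝ) {n : ℕ} (x : Fin n → X) (y : Fin n → ℝ) (u : X) : ℝ :=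
  kvec k x u ⬝ᵥ Matrix.mulVec (gram k x + lam • (1 : Matrix (Fin n) (Fin n) ℝ))⁻¹ y

/-- Posterior covariance. -/
def postCov (k : X → X → ℝ) (lam : ℝ) {n : ℕ} (x : Fin n → X) (u v : X) : ℝ :=
  k u v - kvec k x u ⬝ᵥ
    Matrix.mulVec (gram k x + lam • (1 : Matrix (Fin n) (Fin n) ℝ))⁻¹ (kvec k x v)

/-- Posterior standard deviation: the square root of the posterior variance. -/
def postStd (k : X → X → ℝ) (lam : ℝ) {n : ℕ} (x : Fin n → X) (u : X) : ℝ :=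
  √(postCov k lam x u u)

/-- The first `n` terms `s 0, …, s (n - 1)` of a sequence. If `s 0` is the initial sample and
`s j` the sample of iteration `j`, then `first i s` is the data available when iteration `i`
starts: the initial sample and those of the iterations `1, …, i - 1`. -/
def first {α : Type*} (n : ℕ) (s : ℕ → α) : Fin n → α := fun a => s a

/-- The scale factor `β_i`, with `η_i = 2 / i` and `K_i` the `i × i` kernel matrix of the data
available at iteration `i`. -/
def beta (k : X → X → ℝ) (B R δ : ℝ) (i : ℕ) (z : ℕ → X) : ℝ :=
  B + R * √(2 * Real.log
    (√((1 + 2 / (i : ℝ)) • (1 : Matrix (Fin i) (Fin i) ℝ) + gram k (first i z)).det / δ))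

/-- The upper confidence bound `u ↦ μ_{i-1}(u) + β_i σ_{i-1}(u)` of iteration `i`. -/
def ucb (k : X → X → ℝ) (lam : ℕ → ℝ) (B R δ : ℝ) (i : ℕ) (z : ℕ → X) (y : ℕ → ℝ) (u : X) : ℝ :=
  postMean k (lam i) (first i z) (first i y) u +
    beta k B R δ i z * postStd k (lam i) (first i z) u

/-- The regret bound `F_i = 2 β_i σ_{i-1}(z_i)` of iteration `i`. -/
def regretBound (k : X → X → ℝ) (lam : ℕ → ℝ) (B R δ : ℝ) (i : ℕ) (z : ℕ → X) : ℝ :=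
  2 * beta k B R δ i z * postStd k (lam i) (first i z) (z i)

/-- None of the iterations `1, …, i - 1` met the stopping criterion, so iteration `i` is
carried out. -/
def Reaches (k : X → X → ℝ) (lam : ℕ → ℝ) (B R δ ε : ℝ) (i : ℕ) (z : ℕ → X) : Prop :=
  ∀ j, 1 ≤ j → j < i → ε < regretBound k lam B R δ j z

/-- The algorithm terminates at iteration `i`. -/
def StopsAt (k : X → X → ℝ) (lam : ℕ → ℝ) (B R δ ε : ℝ) (i : ℕ) (z : ℕ → X) : Prop :=
  1 ≤ i ∧ Reaches k lam B R δ ε i z ∧ regretBound k lam B R δ i z ≤ ε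

/-- `(z, y)` is a run of the algorithm: `z 0` is the initial point, and in each iteration that is
carried out `z i` maximizes the upper confidence bound. Nothing is asked of the points after
termination. -/
def IsRun (k : X → X → ℝ) (lam : ℕ → ℝ) (B R δ ε : ℝ) (z : ℕ → X) (y : ℕ → ℝ) : Prop :=
  ∀ i, 1 ≤ i → Reaches k lam B R δ ε i z →
    ∀ u, ucb k lam B R δ i z y u ≤ ucb k lam B R δ i z y (z i)

/-- The value `J^e = μ_{i-1}(z_i) + β_i σ_{i-1}(z_i)` that is returned if the algorithm terminates
at iteration `i`. -/
def output (k : X → X → ℝ) (lam : ℕ → ℝ) (B R δ : ℝ) (i : ℕ) (z : ℕ → X) (y : ℕ → ℝ) : ℝ :=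
  ucb k lam B R δ i z y (z i)

/-- Differential entropy of a Gaussian vector with covariance matrix `S`. -/
def gaussianEntropy {n : ℕ} (S : Matrix (Fin n) (Fin n) ℝ) : ℝ :=
  Real.log ((2 * Real.pi * Real.exp 1) ^ n * S.det) / 2

/-- Mutual information `I(y_A; f_A) = H(y_A) - H(y_A | f_A)`, where `f_A` is Gaussian with the
kernel matrix of the points `x` as covariance and `y_A` is `f_A` plus independent Gaussian noise
of covariance `s I`. -/
def infoGain (k : X → X → ℝ) (s : ℝ) {n : ℕ} (x : Fin n → X) : ℝ :=
  gaussianEntropy (gram k x + s • (1 : Matrix (Fin n) (Fin n) ℝ)) -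
    gaussianEntropy (s • (1 : Matrix (Fin n) (Fin n) ℝ))

/-- Maximum information gain `γ_n` over `n` sample points (which may repeat, as those of the
algorithm may); it is infinite if the gains are unbounded. -/
def maxInfoGain (k : X → X → ℝ) (s : ℝ) (n : ℕ) : ENNReal :=
  ⨆ x : Fin n → X, ENNReal.ofReal (infoGain k s x)

/-- `γ_n = O(n ^ p * log n)` for some `p < 1 / 2`. -/
def SlowInfoGrowth (k : X → X → ℝ) (s : ℝ) : Prop :=
  ∃ C p : ℝ, p < 1 / 2 ∧
    ∀ᶠ n : ℕ in atTop, maxInfoGain k s n ≤ ENNReal.ofReal (C * (n : ℝ) ^ p * Real.log n)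

/-- `ξ` is `R`-sub-Gaussian conditionally on the σ-algebra `m`:
`E[exp (t ξ) | m] ≤ exp (R² t² / 2)` almost surely, for every real `t`. -/
def CondSubGaussian {Ω : Type*} [MeasurableSpace Ω] (P : Measure Ω) (m : MeasurableSpace Ω)
    (R : ℝ) (ξ : Ω → ℝ) : Prop :=
  ∀ t : ℝ, Integrable (fun ω => Real.exp (t * ξ ω)) P ∧
    (P[fun ω => Real.exp (t * ξ ω) | m]) ≤ᵐ[P] fun _ => Real.exp (R ^ 2 * t ^ 2 / 2)

end GPUCB

end

namespace GPUCB

variable {X : Type*}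

open Matrix

/-! ### Quadratic forms of inverses of positive definite matrices. -/

section PosDef

variable {n : ℕ} {A : Matrix (Fin n) (Fin n) ℝ}

/-! With `k u v = ⟪φ u, φ v⟫`, adding a sample multiplies `det (K + λ)` by `λ` plus the posterior
variance at the new point (Schur complement), and changes the fit energy `E(y) = y ⬝ K (K + λ)⁻¹ y`
explicitly (`det_regGram_succ`, `fitEnergy_succ`). Both halves rest on these recursions.

Accuracy: by Cauchy-Schwarz, `|J - μ| ≤ (B + √E(ξ)) σ`, with `E` taken at `λ = 1`, which is the
worst case (`abs_sub_postMean_noisy_le`). The process `exp (E(ξ) / (2 R²)) / √det (1 + K)` starts at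
1 and is a supermartingale: by the recursions its increments are Gaussian mixtures of the
exponentials controlled by sub-Gaussianity (`mixture_succ`, `lintegral_mul_mixture_le`). By Ville's
inequality it never exceeds `1 / δ`, outside an event of probability at most `δ`. Then `B + √E(ξ) ≤
β_i` for all `i ≥ 1` at once, so `J` lies in every band `μ ± β σ`, and both accuracy claims follow
on this single event.

Termination involves no probability. If all regret bounds exceed `ε`, each posterior variance
exceeds `ε² / (4 β²)`. The logarithms of the determinant factors add up to twice the information
gain `g`, and `β²` is at most affine in `g`, so `n` iterations force `n ≤ C (1 + g) g`
(`iterations_le`). This is impossible when `g = o(√n)`. -/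

theorem posDef_mulVec_inv (hA : A.PosDef) (b : Fin n → ℝ) : A *ᵥ (A⁻¹ *ᵥ b) = b := by
  rw [mulVec_mulVec, mul_nonsing_inv _ hA.det_pos.ne'.isUnit, one_mulVec]

theorem posDef_inv_mulVec (hA : A.PosDef) (b : Fin n → ℝ) : A⁻¹ *ᵥ (A *ᵥ b) = b := by
  rw [mulVec_mulVec, nonsing_inv_mul _ hA.det_pos.ne'.isUnit, one_mulVec]

theorem dotProduct_mulVec_symm (hA : A.IsSymm) (b c : Fin n → ℝ) :
    b ⬝ᵥ A *ᵥ c = c ⬝ᵥ A *ᵥ b := by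
  rw [dotProduct_mulVec, ← mulVec_transpose, hA.eq, dotProduct_comm]

theorem posDef_isSymm (hA : A.PosDef) : A.IsSymm := by
  simpa [IsSymm, IsHermitian, conjTranspose_eq_transpose_of_trivial] using hA.isHermitian

theorem posDef_dotProduct_inv_symm (hA : A.PosDef) (b c : Fin n → ℝ) :
    b ⬝ᵥ A⁻¹ *ᵥ c = c ⬝ᵥ A⁻¹ *ᵥ b :=
  dotProduct_mulVec_symm (posDef_isSymm hA.inv) b c

/-- The quadratic form of the inverse as a maximum over `c`. -/
theorem le_dotProduct_inv_mulVec (hA : A.PosDef) (b c : Fin n → ℝ) :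
    2 * (c ⬝ᵥ b) - c ⬝ᵥ A *ᵥ c ≤ b ⬝ᵥ A⁻¹ *ᵥ b := by
  have h := hA.posSemidef.dotProduct_mulVec_nonneg (A⁻¹ *ᵥ b - c)
  have h1 := dotProduct_mulVec_symm (posDef_isSymm hA) (A⁻¹ *ᵥ b) c
  simp only [star_trivial, mulVec_sub, dotProduct_sub, sub_dotProduct, posDef_mulVec_inv hA] at h h1
  rw [h1, dotProduct_comm (A⁻¹ *ᵥ b) b] at h
  linarith

end PosDef

/-- The regularized kernel matrix. -/
noncomputable def regGram (k : X → X → ℝ) (lam : ℝ) {n : ℕ} (x : Fin n → X) : Matrix (Fin n) (Fin n) ℝ :=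
  gram k x + lam • (1 : Matrix (Fin n) (Fin n) ℝ)

theorem regGram_mulVec (k : X → X → ℝ) (lam : ℝ) {n : ℕ} (x : Fin n → X) (c : Fin n → ℝ) :
    regGram k lam x *ᵥ c = gram k x *ᵥ c + lam • c := by
  simp [regGram, add_mulVec, smul_mulVec]

/-! ### The posterior under one additional sample. -/

section FeatureMap

variable {H : Type*} [NormedAddCommGroup H] [InnerProductSpace ℝ H]
  {k : X → X → ℝ} {φ : X → H} {lam : ℝ} {n : ℕ}

theorem dotProduct_gram_mulVec (hφ : ∀ u v, k u v = inner ℝ (φ u) (φ v)) (x : Fin n → X)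
    (c : Fin n → ℝ) : c ⬝ᵥ gram k x *ᵥ c = ‖∑ a, c a • φ (x a)‖ ^ 2 := by
  rw [← real_inner_self_eq_norm_sq, sum_inner]
  simp only [dotProduct, mulVec, gram, of_apply, hφ, inner_sum, inner_smul_left, inner_smul_right,
    Finset.mul_sum]
  simp only [RCLike.conj_to_real]
  refine Finset.sum_congr rfl fun a _ => Finset.sum_congr rfl fun b _ => by ring

theorem kvec_dotProduct (hφ : ∀ u v, k u v = inner ℝ (φ u) (φ v)) (x : Fin n → X)
    (u : X) (c : Fin n → ℝ) : kvec k x u ⬝ᵥ c = inner ℝ (φ u) (∑ a, c a • φ (x a)) := by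
  simp [dotProduct, kvec, hφ, inner_sum, inner_smul_right, mul_comm]

theorem gram_posSemidef (hφ : ∀ u v, k u v = inner ℝ (φ u) (φ v)) (x : Fin n → X) :
    (gram k x).PosSemidef := by
  refine PosSemidef.of_dotProduct_mulVec_nonneg ?_ fun c => ?_
  · ext a b
    simp [gram, hφ, real_inner_comm]
  · rw [star_trivial, dotProduct_gram_mulVec hφ]
    positivity

theorem regGram_posDef (hφ : ∀ u v, k u v = inner ℝ (φ u) (φ v)) (hlam : 0 < lam)
    (x : Fin n → X) : (regGram k lam x).PosDef :=
  PosDef.posSemidef_add (gram_posSemidef hφ x) (PosDef.one.smul hlam)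

/-- The regularized kernel matrix of `n + 1` points in terms of that of the first `n`. -/
theorem regGram_mulVec_castSucc (x : Fin (n + 1) → X) (hsymm : ∀ u v, k u v = k v u)
    (w : Fin n → ℝ) (t : ℝ) :
    regGram k lam x *ᵥ (Fin.snoc w t : Fin (n + 1) → ℝ) =
      Fin.snoc (regGram k lam (Fin.init x) *ᵥ w + t • kvec k (Fin.init x) (x (Fin.last n)))
        (kvec k (Fin.init x) (x (Fin.last n)) ⬝ᵥ w
          + (k (x (Fin.last n)) (x (Fin.last n)) + lam) * t) := by
  ext a
  rw [regGram_mulVec, regGram_mulVec]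
  refine Fin.lastCases ?_ (fun a => ?_) a
  · simp [mulVec, dotProduct, Fin.sum_univ_castSucc, gram, kvec, Fin.init]
    ring
  · simp [mulVec, dotProduct, Fin.sum_univ_castSucc, gram, kvec, Fin.init]
    rw [hsymm (x a.castSucc)]
    ring

/-- The posterior variance bounds the residual of interpolating the feature vector. -/
theorem sq_norm_residual_le_postCov (hφ : ∀ u v, k u v = inner ℝ (φ u) (φ v)) (hlam : 0 < lam)
    (x : Fin n → X) (u : X) :
    ‖φ u - ∑ a, ((regGram k lam x)⁻¹ *ᵥ kvec k x u) a • φ (x a)‖ ^ 2 ≤ postCov k lam x u u := by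
  have hA := regGram_posDef hφ hlam x
  set c := (regGram k lam x)⁻¹ *ᵥ kvec k x u with hc
  -- By this identity the two sides of the claim differ by exactly `lam * (c ⬝ᵥ c)`.
  have h1 : c ⬝ᵥ kvec k x u = c ⬝ᵥ gram k x *ᵥ c + lam * (c ⬝ᵥ c) := by
    rw [← posDef_mulVec_inv hA (kvec k x u), ← hc, regGram_mulVec]
    simp [dotProduct_add]
  have h2 : 0 ≤ c ⬝ᵥ c := by simpa using dotProduct_star_self_nonneg c
  have h3 : postCov k lam x u u = k u u - kvec k x u ⬝ᵥ c := rfl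
  rw [norm_sub_sq_real, ← kvec_dotProduct hφ, ← dotProduct_gram_mulVec hφ, h3,
    ← real_inner_self_eq_norm_sq, ← hφ]
  rw [dotProduct_comm] at h1
  nlinarith [mul_nonneg hlam.le h2]

theorem postCov_self_nonneg (hφ : ∀ u v, k u v = inner ℝ (φ u) (φ v)) (hlam : 0 < lam)
    (x : Fin n → X) (u : X) : 0 ≤ postCov k lam x u u :=
  (sq_nonneg _).trans (sq_norm_residual_le_postCov hφ hlam x u)

/-- The inverse of the regularized kernel matrix of `n + 1` points in terms of the posterior given
the first `n`. -/
theorem regGram_inv_mulVec_succ (hφ : ∀ u v, k u v = inner ℝ (φ u) (φ v)) (hlam : 0 < lam)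
    (x : Fin (n + 1) → X) (y : Fin (n + 1) → ℝ) (t : ℝ)
    (ht : t = (y (Fin.last n) - postMean k lam (Fin.init x) (Fin.init y) (x (Fin.last n))) /
      (lam + postCov k lam (Fin.init x) (x (Fin.last n)) (x (Fin.last n)))) :
    (regGram k lam x)⁻¹ *ᵥ y = Fin.snoc ((regGram k lam (Fin.init x))⁻¹ *ᵥ (Fin.init y) -
      t • ((regGram k lam (Fin.init x))⁻¹ *ᵥ kvec k (Fin.init x) (x (Fin.last n)))) t := by
  have hA := regGram_posDef hφ hlam (Fin.init x)
  have hv := postCov_self_nonneg hφ hlam (Fin.init x) (x (Fin.last n))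
  have hs : ∀ u v, k u v = k v u := fun u v => by rw [hφ, hφ, real_inner_comm]
  -- Multiply the proposed solution by the matrix and compare the two blocks with `y`.
  rw [← posDef_inv_mulVec (regGram_posDef hφ hlam x) (Fin.snoc _ t),
    regGram_mulVec_castSucc x hs]
  congr 1
  ext a
  refine Fin.lastCases ?_ (fun a => ?_) a
  · have h1 : t * (lam + postCov k lam (Fin.init x) (x (Fin.last n)) (x (Fin.last n))) =
        (y (Fin.last n) - postMean k lam (Fin.init x) (Fin.init y) (x (Fin.last n))) := by
      rw [ht]; field_simp
    simp only [postCov, postMean, ← regGram.eq_def] at h1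
    simp only [Fin.snoc_last, dotProduct_sub, dotProduct_smul, smul_eq_mul]
    linarith
  · simp only [Fin.snoc_castSucc, mulVec_sub, mulVec_smul, posDef_mulVec_inv hA]
    simp [Fin.init]

theorem dotProduct_regGram_inv_succ (hφ : ∀ u v, k u v = inner ℝ (φ u) (φ v)) (hlam : 0 < lam)
    (x : Fin (n + 1) → X) (y : Fin (n + 1) → ℝ) :
    y ⬝ᵥ (regGram k lam x)⁻¹ *ᵥ y = Fin.init y ⬝ᵥ (regGram k lam (Fin.init x))⁻¹ *ᵥ Fin.init y +
      (y (Fin.last n) - postMean k lam (Fin.init x) (Fin.init y) (x (Fin.last n))) ^ 2 /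
      (lam + postCov k lam (Fin.init x) (x (Fin.last n)) (x (Fin.last n))) := by
  rw [regGram_inv_mulVec_succ hφ hlam x y _ rfl]
  set t := (y (Fin.last n) - postMean k lam (Fin.init x) (Fin.init y) (x (Fin.last n))) /
      (lam + postCov k lam (Fin.init x) (x (Fin.last n)) (x (Fin.last n))) with ht
  have hA := regGram_posDef hφ hlam (Fin.init x)
  have h1 : ∀ w : Fin n → ℝ, y ⬝ᵥ (Fin.snoc w t : Fin (n + 1) → ℝ) =
      Fin.init y ⬝ᵥ w + y (Fin.last n) * t := fun w => by
    simp [dotProduct, Fin.sum_univ_castSucc, Fin.init]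
  rw [h1, dotProduct_sub, dotProduct_smul, posDef_dotProduct_inv_symm hA (Fin.init y) (kvec _ _ _),
    sq, mul_div_assoc, ← ht]
  simp only [postMean, ← regGram.eq_def, smul_eq_mul]
  ring

/-- By Cramer's rule the last diagonal entry of the inverse is the ratio of the two determinants. By
the block formula with `y` the last unit vector it is also `1 / (lam + variance)`. -/
theorem det_regGram_succ (hφ : ∀ u v, k u v = inner ℝ (φ u) (φ v)) (hlam : 0 < lam)
    (x : Fin (n + 1) → X) :
    (regGram k lam x).det = (regGram k lam (Fin.init x)).det *
      (lam + postCov k lam (Fin.init x) (x (Fin.last n)) (x (Fin.last n))) := by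
  have hv := postCov_self_nonneg hφ hlam (Fin.init x) (x (Fin.last n))
  have hd := (regGram_posDef hφ hlam x).det_pos
  have h := congrFun (regGram_inv_mulVec_succ hφ hlam x (Pi.single (Fin.last n) 1) _ rfl)
    (Fin.last n)
  have h0 : Fin.init (Pi.single (Fin.last n) (1 : ℝ) : Fin (n + 1) → ℝ) = 0 := by
    ext a
    simp [Fin.init, (Fin.castSucc_lt_last a).ne]
  have h2 : (regGram k lam x).submatrix (Fin.last n).succAbove (Fin.last n).succAbove =
      regGram k lam (Fin.init x) := by
    ext a b
    simp [regGram, gram, Fin.init, Matrix.one_apply]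
  rw [mulVec_single_one, Fin.snoc_last, h0, col_apply, inv_def, Matrix.smul_apply,
    adjugate_fin_succ_eq_det_submatrix, h2] at h
  simp [postMean, ← two_mul, pow_mul] at h
  field_simp at h
  linarith

end FeatureMap

/-- The value `y ⬝ K (K + λ)⁻¹ y` of the quadratic form of the hat matrix of kernel regression. -/
noncomputable def fitEnergy (k : X → X → ℝ) (lam : ℝ) {n : ℕ} (x : Fin n → X) (y : Fin n → ℝ) : ℝ :=
  y ⬝ᵥ y - lam * (y ⬝ᵥ (regGram k lam x)⁻¹ *ᵥ y)

/-! ### Fit energy and error bounds for kernel regression. -/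

section FeatureMap

variable {H : Type*} [NormedAddCommGroup H] [InnerProductSpace ℝ H]
  {k : X → X → ℝ} {φ : X → H} {lam : ℝ} {n : ℕ}

/-- For `y = (K + λ) w` the energy equals `|K w|² + λ w ⬝ K w`. -/
theorem fitEnergy_nonneg (hφ : ∀ u v, k u v = inner ℝ (φ u) (φ v)) (hlam : 0 < lam)
    (x : Fin n → X) (y : Fin n → ℝ) : 0 ≤ fitEnergy k lam x y := by
  set w := (regGram k lam x)⁻¹ *ᵥ y with hw
  have hy : y = gram k x *ᵥ w + lam • w := by
    rw [← regGram_mulVec, hw, posDef_mulVec_inv (regGram_posDef hφ hlam x)]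
  have h1 : fitEnergy k lam x y = (gram k x *ᵥ w) ⬝ᵥ (gram k x *ᵥ w)
      + lam * (w ⬝ᵥ gram k x *ᵥ w) := by
    rw [fitEnergy, ← hw]
    conv_lhs => rw [hy]
    simp only [dotProduct_add, add_dotProduct, dotProduct_smul, smul_dotProduct, smul_eq_mul]
    rw [dotProduct_comm w]
    ring
  have h2 : 0 ≤ (gram k x *ᵥ w) ⬝ᵥ (gram k x *ᵥ w) := by
    simpa using dotProduct_star_self_nonneg (gram k x *ᵥ w)
  rw [h1, dotProduct_gram_mulVec hφ]
  positivity

theorem fitEnergy_succ (hφ : ∀ u v, k u v = inner ℝ (φ u) (φ v)) (hlam : 0 < lam)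
    (x : Fin (n + 1) → X) (y : Fin (n + 1) → ℝ) :
    fitEnergy k lam x y = fitEnergy k lam (Fin.init x) (Fin.init y) + (y (Fin.last n) ^ 2 -
      lam * ((y (Fin.last n) - postMean k lam (Fin.init x) (Fin.init y) (x (Fin.last n))) ^ 2 /
      (lam + postCov k lam (Fin.init x) (x (Fin.last n)) (x (Fin.last n))))) := by
  have h1 : y ⬝ᵥ y = Fin.init y ⬝ᵥ Fin.init y + y (Fin.last n) ^ 2 := by
    simp [dotProduct, Fin.sum_univ_castSucc, Fin.init, sq]
  rw [fitEnergy, fitEnergy, dotProduct_regGram_inv_succ hφ hlam, h1]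
  ring

/-- The posterior mean is controlled by the posterior variance and the fit energy. -/
theorem sq_postMean_le (hφ : ∀ u v, k u v = inner ℝ (φ u) (φ v)) (hlam : 0 < lam)
    (x : Fin n → X) (y : Fin n → ℝ) (u : X) :
    lam * postMean k lam x y u ^ 2 ≤ postCov k lam x u u * fitEnergy k lam x y := by
  have hv := postCov_self_nonneg hφ hlam x u
  set v := postCov k lam x u u
  set m := postMean k lam x y u
  -- Append a fictitious observation `t` at `u`. The enlarged energy is a quadratic in `t` that is
  -- never negative, and its discriminant gives the claim.
  have h : ∀ t : ℝ, 0 ≤ v * (t * t) + (2 * lam * m) * t +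
      ((lam + v) * fitEnergy k lam x y - lam * m ^ 2) := fun t => by
    have h1 := fitEnergy_nonneg hφ hlam (Fin.snoc x u : Fin (n + 1) → X)
      (Fin.snoc y t : Fin (n + 1) → ℝ)
    rw [fitEnergy_succ hφ hlam] at h1
    simp only [Fin.init_snoc, Fin.snoc_last] at h1
    have h2 : (lam + v) * (fitEnergy k lam x y + (t ^ 2 - lam * ((t - m) ^ 2 / (lam + v)))) =
        v * (t * t) + (2 * lam * m) * t + ((lam + v) * fitEnergy k lam x y - lam * m ^ 2) := by
      field_simp
      ring
    rw [← h2]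
    exact mul_nonneg (by positivity) h1
  have h3 := discrim_le_zero h
  rw [discrim] at h3
  have h4 : lam * (lam + v) * (lam * m ^ 2) ≤ lam * (lam + v) * (v * fitEnergy k lam x y) := by
    nlinarith
  have h5 : (lam + v) * (lam * m ^ 2) ≤ (lam + v) * (v * fitEnergy k lam x y) := by
    nlinarith
  exact le_of_mul_le_mul_left h5 (by positivity)

theorem dotProduct_mulVec_regGram (k : X → X → ℝ) (lam mu : ℝ) (x : Fin n → X) (c : Fin n → ℝ) :
    c ⬝ᵥ regGram k mu x *ᵥ c = c ⬝ᵥ regGram k lam x *ᵥ c + (mu - lam) * (c ⬝ᵥ c) := by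
  simp only [regGram_mulVec, dotProduct_add, dotProduct_smul, smul_eq_mul]
  ring

/-- The hat matrix has eigenvalues `e / (e + λ)`, decreasing in `λ`. Hence one noise bound, at `λ =
1`, serves every `lam i`. -/
theorem fitEnergy_le_one (hφ : ∀ u v, k u v = inner ℝ (φ u) (φ v)) (hlam : 1 ≤ lam)
    (x : Fin n → X) (y : Fin n → ℝ) : fitEnergy k lam x y ≤ fitEnergy k 1 x y := by
  have h0 : 0 < lam := by linarith
  set c := (regGram k 1 x)⁻¹ *ᵥ y with hc
  have hA := regGram_posDef hφ h0 x
  have h1 : c ⬝ᵥ regGram k 1 x *ᵥ c = c ⬝ᵥ y := by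
    rw [hc, posDef_mulVec_inv (regGram_posDef hφ one_pos x)]
  have h2 : c ⬝ᵥ c ≤ c ⬝ᵥ y := by
    rw [← h1, regGram_mulVec, dotProduct_add, dotProduct_gram_mulVec hφ]
    simp only [one_smul]
    nlinarith [sq_nonneg ‖∑ a, c a • φ (x a)‖]
  -- The test vector `lam⁻¹ • c` is the exact maximizer when `K = 0`.
  have h3 := le_dotProduct_inv_mulVec hA y (lam⁻¹ • c)
  rw [dotProduct_mulVec_regGram k 1 lam] at h3
  simp only [mulVec_smul, smul_dotProduct, dotProduct_smul, smul_eq_mul, h1] at h3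
  rw [fitEnergy, fitEnergy, ← hc, dotProduct_comm y c]
  have h4 := mul_le_mul_of_nonneg_left h3 h0.le
  have h5 : lam * (2 * (lam⁻¹ * (c ⬝ᵥ y)) - (lam⁻¹ * (lam⁻¹ * (c ⬝ᵥ y)) +
      (lam - 1) * (lam⁻¹ * (lam⁻¹ * (c ⬝ᵥ c))))) =
      2 * (c ⬝ᵥ y) - lam⁻¹ * ((c ⬝ᵥ y) + (lam - 1) * (c ⬝ᵥ c)) := by
    field_simp
  rw [h5] at h4
  have h6 : lam⁻¹ * ((c ⬝ᵥ y) + (lam - 1) * (c ⬝ᵥ c)) ≤ c ⬝ᵥ y := by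
    rw [inv_mul_le_iff₀ h0]
    nlinarith
  linarith

/-- The variance increases with the regularization: the solution `c` for `mu` is a test vector in
the variational formula for `lam`. This replaces the varying `lam i` by a common upper bound. -/
theorem postCov_antitone (hφ : ∀ u v, k u v = inner ℝ (φ u) (φ v)) {mu : ℝ} (hlam : 0 < lam)
    (hmu : lam ≤ mu) (x : Fin n → X) (u : X) : postCov k lam x u u ≤ postCov k mu x u u := by
  have hmu0 := hlam.trans_le hmu
  set c := (regGram k mu x)⁻¹ *ᵥ kvec k x u with hc
  have h1 := le_dotProduct_inv_mulVec (regGram_posDef hφ hlam x) (kvec k x u) c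
  have h2 : c ⬝ᵥ regGram k mu x *ᵥ c = c ⬝ᵥ kvec k x u := by
    rw [hc, posDef_mulVec_inv (regGram_posDef hφ hmu0 x)]
  have h3 : 0 ≤ c ⬝ᵥ c := by simpa using dotProduct_star_self_nonneg c
  rw [dotProduct_mulVec_regGram k lam mu] at h2
  simp only [postCov, ← regGram.eq_def, ← hc]
  rw [dotProduct_comm _ c]
  nlinarith [mul_nonneg (sub_nonneg.2 hmu) h3]

/-- The bias of kernel regression from noise-free samples of `J`. -/
theorem abs_sub_postMean_le (hφ : ∀ u v, k u v = inner ℝ (φ u) (φ v)) (hlam : 0 < lam)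
    (x : Fin n → X) (u : X) (J : H) :
    |inner ℝ (φ u) J - postMean k lam x (fun a => inner ℝ (φ (x a)) J) u| ≤
      ‖J‖ * postStd k lam x u := by
  have hA := regGram_posDef hφ hlam x
  -- The error is the inner product of `J` with the interpolation residual of `φ u`.
  have h1 : inner ℝ (φ u) J - postMean k lam x (fun a => inner ℝ (φ (x a)) J) u =
      inner ℝ (φ u - ∑ a, ((regGram k lam x)⁻¹ *ᵥ kvec k x u) a • φ (x a)) J := by
    rw [inner_sub_left, postMean, ← regGram.eq_def, posDef_dotProduct_inv_symm hA, sum_inner,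
      dotProduct]
    simp [inner_smul_left, mul_comm]
  rw [h1]
  refine (abs_real_inner_le_norm _ _).trans ?_
  rw [mul_comm]
  gcongr
  exact Real.le_sqrt_of_sq_le (sq_norm_residual_le_postCov hφ hlam x u)

/-- Error bound for kernel regression from noisy samples of `J`. -/
theorem abs_sub_postMean_noisy_le (hφ : ∀ u v, k u v = inner ℝ (φ u) (φ v)) (hlam : 1 ≤ lam)
    (x : Fin n → X) (u : X) (J : H) (y ξ : Fin n → ℝ)
    (hy : ∀ a, y a = inner ℝ (φ (x a)) J + ξ a) :
    |inner ℝ (φ u) J - postMean k lam x y u| ≤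
      (‖J‖ + √(fitEnergy k 1 x ξ)) * postStd k lam x u := by
  have h0 : 0 < lam := by linarith
  have hv := postCov_self_nonneg hφ h0 x u
  have h1 : postMean k lam x y u =
      postMean k lam x (fun a => inner ℝ (φ (x a)) J) u + postMean k lam x ξ u := by
    have : y = (fun a => inner ℝ (φ (x a)) J) + ξ := funext hy
    simp [this, postMean, mulVec_add, dotProduct_add]
  have h2 : |postMean k lam x ξ u| ≤ √(fitEnergy k 1 x ξ) * postStd k lam x u := by
    rw [postStd, ← Real.sqrt_mul (fitEnergy_nonneg hφ one_pos x ξ)]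
    refine Real.abs_le_sqrt ?_
    have h3 := sq_postMean_le hφ h0 x ξ u
    have h4 := mul_le_mul_of_nonneg_left (fitEnergy_le_one hφ hlam x ξ) hv
    nlinarith [sq_nonneg (postMean k lam x ξ u)]
  have h3 := abs_sub_postMean_le hφ h0 x u J
  rw [h1, ← sub_sub, add_mul]
  exact (abs_sub _ _).trans (add_le_add h3 h2)

/-- The determinants of all regularized kernel matrices in terms of the eigenvalues. -/
theorem exists_eigenvalues (hφ : ∀ u v, k u v = inner ℝ (φ u) (φ v)) (x : Fin n → X) :
    ∃ e : Fin n → ℝ, (∀ a, 0 ≤ e a) ∧ ∀ s, (regGram k s x).det = ∏ a, (e a + s) := by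
  have hK := gram_posSemidef hφ x
  refine ⟨hK.isHermitian.eigenvalues, hK.eigenvalues_nonneg, fun s => ?_⟩
  -- At `-s` the characteristic polynomial is `det (K + s)` up to the sign `(-1) ^ n`.
  have h := Matrix.eval_charpoly (gram k x) (-s)
  rw [hK.isHermitian.charpoly_eq, Polynomial.eval_prod] at h
  have h2 : scalar (Fin n) (-s) - gram k x = -(regGram k s x) := by
    rw [regGram, scalar_apply, ← smul_one_eq_diagonal]
    simp [sub_eq_add_neg, add_comm]
  rw [h2, det_neg] at h
  have h3 : ∀ a, Polynomial.eval (-s) (Polynomial.X - Polynomial.C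
      ((hK.isHermitian.eigenvalues a : ℝ) : ℝ)) = -1 * (hK.isHermitian.eigenvalues a + s) :=
    fun a => by simp; ring
  simp only [RCLike.ofReal_real_eq_id, id] at h
  simp only [h3, Finset.prod_mul_distrib, Finset.prod_const, Finset.card_univ] at h
  exact (mul_left_cancel₀ (by simp) h).symm

end FeatureMap

/-! ### Information gain and the size of the scale factor. -/

section FeatureMap

variable {H : Type*} [NormedAddCommGroup H] [InnerProductSpace ℝ H]
  {k : X → X → ℝ} {φ : X → H} {n : ℕ}

theorem two_mul_infoGain (hφ : ∀ u v, k u v = inner ℝ (φ u) (φ v)) {s : ℝ} (hs : 0 < s)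
    (x : Fin n → X) : 2 * infoGain k s x = Real.log (regGram k s x).det - n * Real.log s := by
  have hd := (regGram_posDef hφ hs x).det_pos
  have hp : (0 : ℝ) < (2 * Real.pi * Real.exp 1) ^ n := by positivity
  have h1 : (s • (1 : Matrix (Fin n) (Fin n) ℝ)).det = s ^ n := by simp
  rw [infoGain, gaussianEntropy, gaussianEntropy, ← regGram.eq_def, h1,
    Real.log_mul hp.ne' hd.ne', Real.log_mul hp.ne' (pow_pos hs n).ne', Real.log_pow s]
  ring

theorem two_mul_infoGain_eq_sum {s : ℝ} (hs : 0 < s)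
    (hφ : ∀ u v, k u v = inner ℝ (φ u) (φ v)) (x : Fin n → X) {e : Fin n → ℝ}
    (he : ∀ a, 0 ≤ e a) (hdet : (regGram k s x).det = ∏ a, (e a + s)) :
    2 * infoGain k s x = ∑ a, Real.log (1 + e a / s) := by
  have h : ∀ a, Real.log (1 + e a / s) = Real.log (e a + s) - Real.log s := fun a => by
    have := he a
    rw [← Real.log_div (by positivity) hs.ne']
    congr 1
    field_simp
    ring
  rw [two_mul_infoGain hφ hs, hdet, Real.log_prod fun a _ => by have := he a; positivity]
  simp [h]

theorem infoGain_antitone (hφ : ∀ u v, k u v = inner ℝ (φ u) (φ v)) {s t : ℝ} (hs : 0 < s)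
    (hst : s ≤ t) (x : Fin n → X) : infoGain k t x ≤ infoGain k s x := by
  obtain ⟨e, he, hdet⟩ := exists_eigenvalues hφ x
  have h1 := two_mul_infoGain_eq_sum hs hφ x he (hdet s)
  have h2 := two_mul_infoGain_eq_sum (hs.trans_le hst) hφ x he (hdet t)
  have h3 : ∑ a, Real.log (1 + e a / t) ≤ ∑ a, Real.log (1 + e a / s) := by
    refine Finset.sum_le_sum fun a _ => ?_
    have := he a
    have := hs.trans_le hst
    exact Real.log_le_log (by positivity) (by gcongr)
  linarith

/-- Bernoulli's inequality `1 + r t ≤ (1 + t) ^ r` with `r = max 1 s` compares the summands for each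
eigenvalue. -/
theorem infoGain_one_le (hφ : ∀ u v, k u v = inner ℝ (φ u) (φ v)) {s : ℝ} (hs : 0 < s)
    (x : Fin n → X) : infoGain k 1 x ≤ max 1 s * infoGain k s x := by
  obtain ⟨e, he, hdet⟩ := exists_eigenvalues hφ x
  have h1 := two_mul_infoGain_eq_sum hs hφ x he (hdet s)
  have h2 := two_mul_infoGain_eq_sum one_pos hφ x he (hdet 1)
  have h3 : ∑ a, Real.log (1 + e a / 1) ≤ max 1 s * ∑ a, Real.log (1 + e a / s) := by
    rw [Finset.mul_sum]
    refine Finset.sum_le_sum fun a _ => ?_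
    have hea := he a
    have hes : 0 ≤ e a / s := by positivity
    rw [← Real.log_rpow (by positivity)]
    refine Real.log_le_log (by positivity) ?_
    refine le_trans ?_ (one_add_mul_self_le_rpow_one_add (by linarith) (le_max_left 1 s))
    have h4 : s * (e a / s) ≤ max 1 s * (e a / s) := by gcongr; exact le_max_right _ _
    rw [mul_div_cancel₀ _ hs.ne'] at h4
    simpa using h4
  rw [← h1, ← h2] at h3
  linarith

theorem infoGain_nonneg (hφ : ∀ u v, k u v = inner ℝ (φ u) (φ v)) {s : ℝ} (hs : 0 < s)
    (x : Fin n → X) : 0 ≤ infoGain k s x := by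
  obtain ⟨e, he, hdet⟩ := exists_eigenvalues hφ x
  have h1 := two_mul_infoGain_eq_sum hs hφ x he (hdet s)
  have h3 : 0 ≤ ∑ a, Real.log (1 + e a / s) := Finset.sum_nonneg fun a _ =>
    Real.log_nonneg (by have := he a; have : 0 ≤ e a / s := by positivity
                        linarith)
  linarith

/-- The determinant in the scale factor exceeds `det (1 + K)`, by a bounded factor. -/
theorem log_det_one_add_bounds (hφ : ∀ u v, k u v = inner ℝ (φ u) (φ v)) (hn : 1 ≤ n)
    (x : Fin n → X) :
    (regGram k 1 x).det ≤ ((1 + 2 / (n : ℝ)) • (1 : Matrix (Fin n) (Fin n) ℝ) + gram k x).det ∧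
    Real.log ((1 + 2 / (n : ℝ)) • (1 : Matrix (Fin n) (Fin n) ℝ) + gram k x).det ≤
      2 + 2 * infoGain k 1 x := by
  have hn0 : (0 : ℝ) < n := by exact_mod_cast hn
  have hs : (0 : ℝ) < 1 + 2 / (n : ℝ) := by positivity
  have h1s : (1 : ℝ) ≤ 1 + 2 / (n : ℝ) := by
    have : (0 : ℝ) ≤ 2 / n := by positivity
    linarith
  rw [add_comm, ← regGram.eq_def]
  constructor
  · obtain ⟨e, he, hdet⟩ := exists_eigenvalues hφ x
    rw [hdet, hdet]
    exact Finset.prod_le_prod (fun a _ => by have := he a; positivity) fun a _ => by gcongr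
  · have h1 := two_mul_infoGain hφ hs x
    have h2 := infoGain_antitone hφ one_pos h1s x
    have h3 := Real.log_le_sub_one_of_pos hs
    -- The regularization `1 + 2 / n` adds at most 2 to the logarithm; this is the constant in the
    -- bound.
    have h4 : (n : ℝ) * Real.log (1 + 2 / n) ≤ n * (2 / n) := by
      gcongr
      linarith
    rw [mul_div_cancel₀ _ hn0.ne'] at h4
    linarith

theorem one_le_det_regGram_one (hφ : ∀ u v, k u v = inner ℝ (φ u) (φ v)) (x : Fin n → X) :
    1 ≤ (regGram k 1 x).det := by
  have h1 := infoGain_nonneg hφ one_pos x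
  have h2 := two_mul_infoGain hφ one_pos x
  rw [Real.log_one] at h2
  have h3 : 0 ≤ Real.log (regGram k 1 x).det := by linarith
  exact (Real.log_nonneg_iff (regGram_posDef hφ one_pos x).det_pos).1 h3

theorem init_first {α : Type*} (n : ℕ) (s : ℕ → α) : Fin.init (first (n + 1) s) = first n s := rfl

theorem first_last {α : Type*} (n : ℕ) (s : ℕ → α) : first (n + 1) s (Fin.last n) = s n := by
  simp [first]

/-- Chain rule for mutual information: each sample contributes the logarithm of its determinant
factor. -/
theorem two_mul_infoGain_first (hφ : ∀ u v, k u v = inner ℝ (φ u) (φ v)) {s : ℝ} (hs : 0 < s)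
    (z : ℕ → X) (n : ℕ) : 2 * infoGain k s (first n z) =
      ∑ j ∈ Finset.range n, Real.log (1 + postCov k s (first j z) (z j) (z j) / s) := by
  induction n with
  | zero => simp [two_mul_infoGain hφ hs]
  | succ n ih =>
    have hd := (regGram_posDef hφ hs (first n z)).det_pos
    have hv := postCov_self_nonneg hφ hs (first n z) (z n)
    rw [Finset.sum_range_succ, ← ih, two_mul_infoGain hφ hs, two_mul_infoGain hφ hs,
      det_regGram_succ hφ hs, init_first, first_last, Real.log_mul hd.ne' (by positivity),
      one_add_div hs.ne', Real.log_div (by positivity) hs.ne']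
    push_cast
    ring

theorem infoGain_first_mono (hφ : ∀ u v, k u v = inner ℝ (φ u) (φ v)) {s : ℝ} (hs : 0 < s)
    (z : ℕ → X) : Monotone fun n => infoGain k s (first n z) := by
  refine monotone_nat_of_le_succ fun n => ?_
  have h1 := two_mul_infoGain_first hφ hs z n
  have h2 := two_mul_infoGain_first hφ hs z (n + 1)
  rw [Finset.sum_range_succ] at h2
  have hv := postCov_self_nonneg hφ hs (first n z) (z n)
  have h3 : 0 ≤ Real.log (1 + postCov k s (first n z) (z n) (z n) / s) := Real.log_nonneg (by
    have : 0 ≤ postCov k s (first n z) (z n) (z n) / s := by positivity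
    linarith)
  linarith

/-- Combine `(B + R r)² ≤ 2 B² + 2 R² r²` with the bound on the log determinant. -/
theorem beta_sq_le (hφ : ∀ u v, k u v = inner ℝ (φ u) (φ v)) {B R δ s : ℝ}
    (hδ : 0 < δ) (hδ1 : δ ≤ 1) (hs : 0 < s) (z : ℕ → X) (hn : 1 ≤ n) :
    beta k B R δ n z ^ 2 ≤ 2 * B ^ 2 + 4 * R ^ 2 *
      (1 - Real.log δ + max 1 s * infoGain k s (first n z)) := by
  obtain ⟨h1, h2⟩ := log_det_one_add_bounds hφ hn (first n z)
  have h3 := (one_le_det_regGram_one hφ (first n z)).trans h1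
  have h4 := infoGain_one_le hφ hs (first n z)
  have hδl : Real.log δ ≤ 0 := Real.log_nonpos hδ.le hδ1
  rw [beta]
  set d := ((1 + 2 / (n : ℝ)) • (1 : Matrix (Fin n) (Fin n) ℝ) + gram k (first n z)).det
  have hd : 0 < d := by linarith
  have h5 : Real.log (√d / δ) = Real.log d / 2 - Real.log δ := by
    rw [Real.log_div (Real.sqrt_pos.2 hd).ne' hδ.ne', Real.log_sqrt hd.le]
  have h6 := Real.log_nonneg h3
  have h7 : √(2 * Real.log (√d / δ)) ^ 2 = Real.log d - 2 * Real.log δ := by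
    rw [h5, Real.sq_sqrt (by linarith)]
    ring
  set r := √(2 * Real.log (√d / δ))
  have h8 : r ^ 2 ≤ 2 * (1 - Real.log δ + max 1 s * infoGain k s (first n z)) := by linarith
  nlinarith [sq_nonneg (B - R * r), mul_le_mul_of_nonneg_left h8 (sq_nonneg R)]

end FeatureMap

/-- In a sequence that never meets the stopping criterion every regret bound exceeds `ε`. -/
theorem regretBound_gt_of_not_stopsAt {k : X → X → ℝ} {lam : ℕ → ℝ} {B R δ ε : ℝ} {z : ℕ → X}
    (h : ∀ i, ¬ StopsAt k lam B R δ ε i z) (i : ℕ) (hi : 1 ≤ i) :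
    ε < regretBound k lam B R δ i z := by
  induction i using Nat.strong_induction_on with
  | _ i ih =>
    by_contra hc
    exact h i ⟨hi, fun j hj hji => ih j hji hj, not_lt.1 hc⟩

/-! ### Termination. -/

section Termination

variable {H : Type*} [NormedAddCommGroup H] [InnerProductSpace ℝ H]
  {k : X → X → ℝ} {φ : X → H}

/-- As long as the regret bounds exceed `ε`, the information gain has to grow. -/
theorem iterations_le (hφ : ∀ u v, k u v = inner ℝ (φ u) (φ v)) {B R δ ε s Lam : ℝ}
    (hδ : 0 < δ) (hδ1 : δ ≤ 1) (hε : 0 < ε) (hs : 0 < s) (hsL : s ≤ Lam)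
    {lam : ℕ → ℝ} (hlam : ∀ i, 1 ≤ lam i ∧ lam i ≤ Lam) (z : ℕ → X)
    (h : ∀ i, 1 ≤ i → ε < regretBound k lam B R δ i z) (n : ℕ) :
    n * ε ^ 2 ≤ (4 * Lam * (2 * B ^ 2 + 4 * R ^ 2 *
      (1 - Real.log δ + max 1 s * infoGain k s (first (n + 1) z))) + ε ^ 2) *
      (2 * infoGain k s (first (n + 1) z)) := by
  set b := 2 * B ^ 2 + 4 * R ^ 2 *
      (1 - Real.log δ + max 1 s * infoGain k s (first (n + 1) z)) with hb
  have hL : 0 < Lam := hs.trans_le hsL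
  have hb0 : 0 ≤ b := (sq_nonneg _).trans
    (beta_sq_le (B := B) (R := R) hφ hδ hδ1 hs z (Nat.le_add_left 1 n))
  -- From `β² ≤ b` one gets `ε² ≤ 4 b w`; then `log (1 + x) ≥ x / (1 + x)` at `x = w / Lam` gives a
  -- lower bound independent of `j`.
  have hterm : ∀ j ∈ Finset.range n, ε ^ 2 / (4 * Lam * b + ε ^ 2) ≤
      Real.log (1 + postCov k Lam (first (j + 1) z) (z (j + 1)) (z (j + 1)) / Lam) := by
    intro j hj
    have hj' : j < n := Finset.mem_range.1 hj
    have hlj := hlam (j + 1)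
    have hl0 : 0 < lam (j + 1) := by linarith
    have h1 := h (j + 1) (Nat.le_add_left 1 j)
    rw [regretBound, postStd] at h1
    have h2 := beta_sq_le (B := B) (R := R) hφ hδ hδ1 hs z (Nat.le_add_left 1 j)
    have h3 : beta k B R δ (j + 1) z ^ 2 ≤ b := by
      refine h2.trans ?_
      rw [hb]
      gcongr
      exact infoGain_first_mono hφ hs z (by omega)
    have h4 := postCov_antitone hφ hl0 hlj.2 (first (j + 1) z) (z (j + 1))
    have h5 := postCov_self_nonneg hφ hl0 (first (j + 1) z) (z (j + 1))
    set v := postCov k (lam (j + 1)) (first (j + 1) z) (z (j + 1)) (z (j + 1))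
    set w := postCov k Lam (first (j + 1) z) (z (j + 1)) (z (j + 1))
    have hw : 0 ≤ w := h5.trans h4
    have h6 : ε ^ 2 ≤ 4 * b * w := by
      have h7 : ε ^ 2 ≤ (2 * beta k B R δ (j + 1) z * √v) ^ 2 := by gcongr
      rw [mul_pow, mul_pow, Real.sq_sqrt h5] at h7
      refine h7.trans ?_
      norm_num
      gcongr
    have h8 := Real.one_sub_inv_le_log_of_pos (x := 1 + w / Lam) (by positivity)
    refine le_trans ?_ h8
    have h9 : 1 - (1 + w / Lam)⁻¹ = w / (Lam + w) := by field_simp; ring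
    rw [h9, div_le_div_iff₀ (by positivity) (by
      rcases hw.lt_or_eq with h | h
      · positivity
      · linarith)]
    nlinarith
  have h1 := Finset.sum_le_sum hterm
  have h2 := two_mul_infoGain_first hφ hL z (n + 1)
  -- Split off the initial sample, which no stopping test concerns; its term is nonnegative.
  rw [Finset.sum_range_succ'] at h2
  have h3 : 0 ≤ Real.log (1 + postCov k Lam (first 0 z) (z 0) (z 0) / Lam) := Real.log_nonneg (by
    have := postCov_self_nonneg hφ hL (first 0 z) (z 0)
    have : 0 ≤ postCov k Lam (first 0 z) (z 0) (z 0) / Lam := by positivity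
    linarith)
  have h4 := infoGain_antitone hφ hs hsL (first (n + 1) z)
  rw [Finset.sum_const, Finset.card_range, nsmul_eq_mul] at h1
  have h5 : n * (ε ^ 2 / (4 * Lam * b + ε ^ 2)) ≤ 2 * infoGain k s (first (n + 1) z) := by
    linarith
  rwa [← mul_div_assoc, div_le_iff₀ (by positivity), mul_comm (2 * _)] at h5

/-- `log n = o(n ^ (1 / 2 - p))`. The threshold `√n` matters because `iterations_le` is quadratic in
the gain. -/
theorem SlowInfoGrowth.isLittleO (hφ : ∀ u v, k u v = inner ℝ (φ u) (φ v)) {s : ℝ} (hs : 0 < s)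
    (h : SlowInfoGrowth k s) (z : ℕ → X) :
    (fun n : ℕ => infoGain k s (first n z)) =o[atTop] fun n : ℕ => (n : ℝ) ^ (1 / 2 : ℝ) := by
  obtain ⟨C, p, hp, hC⟩ := h
  have h1 : (fun x : ℝ => x ^ p * Real.log x) =o[atTop] fun x : ℝ => x ^ (1 / 2 : ℝ) := by
    have h2 := (Asymptotics.isBigO_refl (fun x : ℝ => x ^ p) atTop).mul_isLittleO
      (isLittleO_log_rpow_atTop (r := 1 / 2 - p) (by linarith))
    refine h2.congr' EventuallyEq.rfl ?_
    filter_upwards [eventually_gt_atTop 0] with x hx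
    rw [← Real.rpow_add hx]
    congr 1
    ring
  have h2 := h1.comp_tendsto tendsto_natCast_atTop_atTop
  refine Asymptotics.IsBigO.trans_isLittleO ?_ h2
  refine Asymptotics.IsBigO.of_bound |C| ?_
  filter_upwards [hC] with n hn
  have h3 : ENNReal.ofReal (infoGain k s (first n z)) ≤
      ENNReal.ofReal |C * (n : ℝ) ^ p * Real.log n| :=
    ((le_iSup (fun x : Fin n → X => ENNReal.ofReal (infoGain k s x)) (first n z)).trans hn).trans
      (ENNReal.ofReal_le_ofReal (le_abs_self _))
  rw [ENNReal.ofReal_le_ofReal_iff (abs_nonneg _)] at h3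
  rw [Real.norm_of_nonneg (infoGain_nonneg hφ hs _), Function.comp_apply, Real.norm_eq_abs,
    ← abs_mul, ← mul_assoc]
  exact h3

theorem exists_stopsAt (hφ : ∀ u v, k u v = inner ℝ (φ u) (φ v)) {B R δ ε s Lam : ℝ}
    (hδ : 0 < δ) (hδ1 : δ ≤ 1) (hε : 0 < ε) (hs : 0 < s)
    {lam : ℕ → ℝ} (hlam : ∀ i, 1 ≤ lam i ∧ lam i ≤ Lam) (hslow : SlowInfoGrowth k s)
    (z : ℕ → X) : ∃ i, StopsAt k lam B R δ ε i z := by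
  by_contra! hc
  have h := iterations_le hφ hδ hδ1 hε hs (le_max_right Lam s)
    (fun i => ⟨(hlam i).1, (hlam i).2.trans (le_max_left _ _)⟩) z
    (regretBound_gt_of_not_stopsAt hc)
  have ho := hslow.isLittleO hφ hs z
  set g : ℕ → ℝ := fun n => infoGain k s (first n z) with hg
  set r : ℕ → ℝ := fun n => (n : ℝ) ^ (1 / 2 : ℝ) with hr
  set L := max Lam s
  have hsq : ∀ n, r n * r n = n := fun n => by
    rw [hr]
    simp only
    rw [← Real.sqrt_eq_rpow, Real.mul_self_sqrt (Nat.cast_nonneg n)]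
  have hone : (fun _ : ℕ => (1 : ℝ)) =O[atTop] r := by
    refine Asymptotics.IsBigO.of_bound 1 ?_
    filter_upwards [eventually_ge_atTop 1] with n hn
    have : (1 : ℝ) ≤ n := by exact_mod_cast hn
    rw [one_mul, norm_one]
    exact (Real.one_le_rpow this (by norm_num)).trans (le_abs_self _)
  have hfac : (fun n => 4 * L * (2 * B ^ 2 + 4 * R ^ 2 * (1 - Real.log δ + max 1 s * g n)) + ε ^ 2)
      =O[atTop] r := by
    have hc : ∀ c : ℝ, (fun _ : ℕ => c) =O[atTop] r := fun c => by
      simpa using hone.const_mul_left c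
    exact ((((hc _).add (((hc _).add (ho.isBigO.const_mul_left _)).const_mul_left _)).const_mul_left
      _).add (hc _))
  have hprod := hfac.mul_isLittleO (ho.const_mul_left 2)
  have hlit : (fun n : ℕ => ((n : ℝ) - 1) * ε ^ 2) =o[atTop] fun n : ℕ => (n : ℝ) := by
    refine Asymptotics.IsBigO.trans_isLittleO ?_ (hprod.congr_right hsq)
    refine Asymptotics.IsBigO.of_bound 1 ?_
    filter_upwards [eventually_ge_atTop 1] with n hn
    obtain ⟨m, rfl⟩ : ∃ m, n = m + 1 := ⟨n - 1, by omega⟩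
    have hm := h m
    rw [one_mul, Real.norm_of_nonneg (by push_cast; simp; positivity)]
    refine le_trans ?_ (le_abs_self _)
    push_cast
    simpa using hm
  -- For `n ≥ 2` the left side is at least `ε² n / 2`, so `ε² / 4` is small enough.
  have hbd := hlit.bound (c := ε ^ 2 / 4) (by positivity)
  obtain ⟨n, hn1, hn2⟩ := (hbd.and (eventually_ge_atTop 2)).exists
  have hn3 : (2 : ℝ) ≤ n := by exact_mod_cast hn2
  rw [Real.norm_of_nonneg (mul_nonneg (by linarith) (sq_nonneg ε)),
    Real.norm_of_nonneg (by linarith)] at hn1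
  nlinarith [sq_pos_of_pos hε]

end Termination

/-! ### Exponential inequalities and the method of mixtures. -/

section SubGaussian

variable {Ω : Type*} {m m₀ : MeasurableSpace Ω} {P : Measure Ω} [IsProbabilityMeasure P]
  {R : ℝ} {ξ : Ω → ℝ}

/-- On `m`, the measure with density `exp (c ξ)` is dominated by a multiple of `P`; integrate `g`
against both. -/
theorem lintegral_mul_exp_const_le (hm : m ≤ m₀) (hξ : Measurable ξ)
    (h : CondSubGaussian P m R ξ) (c : ℝ) {g : Ω → ENNReal} (hg : Measurable[m] g) :
    ∫⁻ ω, g ω * ENNReal.ofReal (Real.exp (c * ξ ω)) ∂P ≤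
      ENNReal.ofReal (Real.exp (R ^ 2 * c ^ 2 / 2)) * ∫⁻ ω, g ω ∂P := by
  obtain ⟨hint, hle⟩ := h c
  have hexp : Measurable fun ω => ENNReal.ofReal (Real.exp (c * ξ ω)) := by fun_prop
  have hmeas : (P.withDensity fun ω => ENNReal.ofReal (Real.exp (c * ξ ω))).trim hm ≤
      (ENNReal.ofReal (Real.exp (R ^ 2 * c ^ 2 / 2)) • P).trim hm := by
    refine Measure.le_iff.2 fun s hs => ?_
    have hs' := hm s hs
    rw [trim_measurableSet_eq hm hs, trim_measurableSet_eq hm hs, withDensity_apply _ hs',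
      Measure.smul_apply, smul_eq_mul,
      ← ofReal_integral_eq_lintegral_ofReal hint.integrableOn
        (Eventually.of_forall fun ω => (Real.exp_pos _).le),
      ← setIntegral_condExp hm hint hs]
    calc ENNReal.ofReal (∫ ω in s, (P[fun ω => Real.exp (c * ξ ω) | m]) ω ∂P)
        ≤ ENNReal.ofReal (∫ _ in s, Real.exp (R ^ 2 * c ^ 2 / 2) ∂P) := by
          refine ENNReal.ofReal_le_ofReal (integral_mono_ae integrable_condExp.integrableOn
            (integrable_const _) (ae_restrict_of_ae hle))
      _ = ENNReal.ofReal (Real.exp (R ^ 2 * c ^ 2 / 2)) * P s := by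
          rw [setIntegral_const, smul_eq_mul, mul_comm, ENNReal.ofReal_mul (Real.exp_pos _).le,
            ofReal_measureReal]
  have h1 := lintegral_mono' hmeas (le_refl g)
  rw [lintegral_trim hm hg, lintegral_trim hm hg, lintegral_smul_measure,
    lintegral_withDensity_eq_lintegral_mul _ hexp (hg.mono hm le_rfl)] at h1
  simpa [mul_comm] using h1

/-- Split `g` along the level sets of `f`, on each of which the parameter is constant. -/
theorem lintegral_mul_exp_le_of_finite_range (hm : m ≤ m₀) (hξ : Measurable ξ)
    (h : CondSubGaussian P m R ξ) {f : Ω → ℝ} (hf : Measurable[m] f)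
    (hfin : (Set.range f).Finite) {g : Ω → ENNReal} (hg : Measurable[m] g) :
    ∫⁻ ω, g ω * ENNReal.ofReal (Real.exp (f ω * ξ ω - R ^ 2 * f ω ^ 2 / 2)) ∂P ≤
      ∫⁻ ω, g ω ∂P := by
  set G : ℝ → Ω → ENNReal := fun c => (f ⁻¹' {c}).indicator g with hG
  have hGm : ∀ c, Measurable[m] (G c) := fun c => hg.indicator (hf (measurableSet_singleton c))
  have hsum : ∀ (F : ℝ → ENNReal) (ω : Ω), ∑ c ∈ hfin.toFinset, G c ω * F c = g ω * F (f ω) := by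
    intro F ω
    rw [Finset.sum_eq_single (f ω)]
    · simp [hG]
    · intro c _ hc
      simp [hG, hc.symm]
    · intro hc
      exact absurd (hfin.mem_toFinset.2 ⟨ω, rfl⟩) hc
  have h1 : ∀ ω, g ω * ENNReal.ofReal (Real.exp (f ω * ξ ω - R ^ 2 * f ω ^ 2 / 2)) =
      ∑ c ∈ hfin.toFinset, G c ω * ENNReal.ofReal (Real.exp (c * ξ ω - R ^ 2 * c ^ 2 / 2)) :=
    fun ω => (hsum (fun c => ENNReal.ofReal (Real.exp (c * ξ ω - R ^ 2 * c ^ 2 / 2))) ω).symm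
  have h2 : ∀ ω, g ω = ∑ c ∈ hfin.toFinset, G c ω := fun ω => by
    simpa using (hsum (fun _ => 1) ω).symm
  simp_rw [h1]
  have hGm' : ∀ c, Measurable (G c) := fun c => (hGm c).mono hm le_rfl
  rw [lintegral_finsetSum _ fun c _ => by fun_prop]
  simp_rw [h2]
  rw [lintegral_finsetSum _ fun c _ => hGm' c]
  refine Finset.sum_le_sum fun c _ => ?_
  have h3 : ∀ ω, G c ω * ENNReal.ofReal (Real.exp (c * ξ ω - R ^ 2 * c ^ 2 / 2)) =
      ENNReal.ofReal (Real.exp (-(R ^ 2 * c ^ 2 / 2))) *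
        (G c ω * ENNReal.ofReal (Real.exp (c * ξ ω))) := fun ω => by
    rw [sub_eq_add_neg, Real.exp_add, ENNReal.ofReal_mul (Real.exp_pos _).le]
    ring
  simp_rw [h3]
  rw [lintegral_const_mul _ (by fun_prop)]
  refine (mul_le_mul_right (lintegral_mul_exp_const_le hm hξ h c (hGm c)) _).trans ?_
  rw [← mul_assoc, ← ENNReal.ofReal_mul (Real.exp_pos _).le, ← Real.exp_add]
  simp

/-- The exponential bound for conditionally sub-Gaussian noise, with a random parameter. -/
theorem lintegral_mul_exp_le (hm : m ≤ m₀) (hξ : Measurable ξ)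
    (h : CondSubGaussian P m R ξ) {a : Ω → ℝ} (ha : Measurable[m] a)
    {g : Ω → ENNReal} (hg : Measurable[m] g) :
    ∫⁻ ω, g ω * ENNReal.ofReal (Real.exp (a ω * ξ ω - R ^ 2 * a ω ^ 2 / 2)) ∂P ≤
      ∫⁻ ω, g ω ∂P := by
  have hs : StronglyMeasurable[m] a := ha.stronglyMeasurable
  set F : ℕ → Ω → ENNReal := fun n ω =>
    g ω * ENNReal.ofReal (Real.exp (hs.approx n ω * ξ ω - R ^ 2 * hs.approx n ω ^ 2 / 2)) with hF
  have hFm : ∀ n, Measurable (F n) := fun n => by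
    have h1 : Measurable (hs.approx n) := (@SimpleFunc.measurable _ _ m _ (hs.approx n)).mono hm le_rfl
    have h2 : Measurable g := hg.mono hm le_rfl
    simp only [hF]
    fun_prop
  have hlim : ∀ ω, Tendsto (fun n => F n ω) atTop
      (nhds (g ω * ENNReal.ofReal (Real.exp (a ω * ξ ω - R ^ 2 * a ω ^ 2 / 2)))) := fun ω => by
    refine ENNReal.Tendsto.const_mul ?_ (Or.inl (by simp [Real.exp_pos]))
    have h1 := hs.tendsto_approx ω
    have h2 : Continuous fun t : ℝ =>
      ENNReal.ofReal (Real.exp (t * ξ ω - R ^ 2 * t ^ 2 / 2)) :=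
      ENNReal.continuous_ofReal.comp (by fun_prop)
    exact (h2.tendsto _).comp h1
  -- Fatou's lemma along simple approximations of `a`.
  calc ∫⁻ ω, g ω * ENNReal.ofReal (Real.exp (a ω * ξ ω - R ^ 2 * a ω ^ 2 / 2)) ∂P
      = ∫⁻ ω, liminf (fun n => F n ω) atTop ∂P := by simp_rw [fun ω => (hlim ω).liminf_eq]
    _ ≤ liminf (fun n => ∫⁻ ω, F n ω ∂P) atTop := lintegral_liminf_le hFm
    _ ≤ liminf (fun _ : ℕ => ∫⁻ ω, g ω ∂P) atTop :=
        liminf_le_liminf (Eventually.of_forall fun n =>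
          lintegral_mul_exp_le_of_finite_range hm hξ h (@SimpleFunc.measurable _ _ m _ (hs.approx n))
            (@SimpleFunc.finite_range _ _ m (hs.approx n)) hg)
    _ = ∫⁻ ω, g ω ∂P := by simp

/-- A Gaussian mixture of exponentials of linear functions. -/
theorem lintegral_gaussian_mixture (hR : 0 < R) (x μ : ℝ) {v : ℝ} (hv : 0 ≤ v) :
    ∫⁻ w : ℝ, ENNReal.ofReal ((√(2 * Real.pi))⁻¹ * Real.exp (-w ^ 2 / 2)) *
      ENNReal.ofReal (Real.exp ((μ / R + √v * w) / R * x -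
        R ^ 2 * ((μ / R + √v * w) / R) ^ 2 / 2)) =
      ENNReal.ofReal ((√(1 + v))⁻¹ *
        Real.exp ((x ^ 2 - (x - μ) ^ 2 / (1 + v)) / (2 * R ^ 2))) := by
  have h1v : 0 < 1 + v := by linarith
  set E := Real.exp ((x ^ 2 - (x - μ) ^ 2 / (1 + v)) / (2 * R ^ 2)) with hE
  -- The centre obtained by completing the square in `w`.
  set c := (x - μ) / R * √v / (1 + v) with hc
  have h1 : ∀ w : ℝ, ENNReal.ofReal ((√(2 * Real.pi))⁻¹ * Real.exp (-w ^ 2 / 2)) *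
      ENNReal.ofReal (Real.exp ((μ / R + √v * w) / R * x -
        R ^ 2 * ((μ / R + √v * w) / R) ^ 2 / 2)) =
      ENNReal.ofReal (((√(2 * Real.pi))⁻¹ * E) * Real.exp (-((1 + v) / 2) * (w - c) ^ 2)) := by
    intro w
    rw [← ENNReal.ofReal_mul (by positivity), mul_assoc, mul_assoc, ← Real.exp_add, hE,
      ← Real.exp_add]
    congr 3
    have hsq : √v ^ 2 = v := Real.sq_sqrt hv
    have hv2 : v = √v ^ 2 := hsq.symm
    have h1v' : 1 + √v ^ 2 ≠ 0 := by rw [hsq]; exact h1v.ne'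
    rw [hc]
    generalize √v = r at *
    subst hv2
    field_simp
    ring
  have hint : Integrable fun w : ℝ =>
      ((√(2 * Real.pi))⁻¹ * E) * Real.exp (-((1 + v) / 2) * (w - c) ^ 2) :=
    ((integrable_exp_neg_mul_sq (b := (1 + v) / 2) (by positivity)).comp_sub_right c).const_mul _
  simp_rw [h1]
  rw [← ofReal_integral_eq_lintegral_ofReal hint (Eventually.of_forall fun w => by positivity),
    integral_const_mul, integral_sub_right_eq_self (fun w => Real.exp (-((1 + v) / 2) * w ^ 2)),
    integral_gaussian]
  congr 1
  have h2 : Real.pi / ((1 + v) / 2) = (2 * Real.pi) / (1 + v) := by field_simp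
  rw [h2, Real.sqrt_div (by positivity)]
  have : √(2 * Real.pi) ≠ 0 := by positivity
  field_simp

/-- One step of the method of mixtures. -/
theorem lintegral_mul_mixture_le (hm : m ≤ m₀) (hR : 0 < R) (hξ : Measurable ξ)
    (h : CondSubGaussian P m R ξ) {μ v : Ω → ℝ} (hμ : Measurable[m] μ) (hv : Measurable[m] v)
    (hv0 : ∀ ω, 0 ≤ v ω) {g : Ω → ENNReal} (hg : Measurable[m] g) :
    ∫⁻ ω, g ω * ENNReal.ofReal ((√(1 + v ω))⁻¹ *
        Real.exp ((ξ ω ^ 2 - (ξ ω - μ ω) ^ 2 / (1 + v ω)) / (2 * R ^ 2))) ∂P ≤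
      ∫⁻ ω, g ω ∂P := by
  have hg' : Measurable g := hg.mono hm le_rfl
  have hμ' : Measurable μ := hμ.mono hm le_rfl
  have hv' : Measurable v := hv.mono hm le_rfl
  set ρ : ℝ → ENNReal := fun w =>
    ENNReal.ofReal ((√(2 * Real.pi))⁻¹ * Real.exp (-w ^ 2 / 2)) with hρ
  have hρm : Measurable ρ := by simp only [hρ]; fun_prop
  -- For fixed `w` this parameter is `m`-measurable, so after Tonelli the random-parameter bound
  -- applies for each `w`.
  set a : ℝ → Ω → ℝ := fun w ω => (μ ω / R + √(v ω) * w) / R with ha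
  set F : Ω → ℝ → ENNReal := fun ω w => ρ w *
    (g ω * ENNReal.ofReal (Real.exp (a w ω * ξ ω - R ^ 2 * a w ω ^ 2 / 2))) with hF
  have hFm : Measurable (Function.uncurry F) := by
    simp only [hF, ha, Function.uncurry_def]
    fun_prop
  have hρ1 : ∫⁻ w, ρ w = 1 := by
    -- With `x = μ = v = 0` the mixture formula says that the Gaussian density has mass 1.
    have h1 := lintegral_gaussian_mixture (R := 1) one_pos 0 0 le_rfl
    simp only [Real.sqrt_zero, zero_mul, zero_div, add_zero, mul_zero, ne_eq, OfNat.ofNat_ne_zero,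
      not_false_eq_true, zero_pow, sub_zero, Real.exp_zero, ENNReal.ofReal_one, mul_one,
      Real.sqrt_one, inv_one] at h1
    exact h1
  calc _ = ∫⁻ ω, (∫⁻ w, F ω w) ∂P := by
        refine lintegral_congr fun ω => ?_
        rw [← lintegral_gaussian_mixture hR (ξ ω) (μ ω) (hv0 ω),
          ← lintegral_const_mul _ (by fun_prop)]
        refine lintegral_congr fun w => ?_
        simp only [hF, ha, hρ]
        ring
    _ = ∫⁻ w, (∫⁻ ω, F ω w ∂P) := lintegral_lintegral_swap hFm.aemeasurable
    _ ≤ ∫⁻ w, (ρ w * ∫⁻ ω, g ω ∂P) := by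
        refine lintegral_mono fun w => ?_
        have haw : Measurable[m] (a w) := by
          simp only [ha]
          exact ((hμ.div_const R).add (hv.sqrt.mul_const w)).div_const R
        have haw' : Measurable (a w) := haw.mono hm le_rfl
        simp only [hF]
        rw [lintegral_const_mul _ (by fun_prop)]
        exact mul_le_mul_right (lintegral_mul_exp_le hm hξ h haw hg) _
    _ = ∫⁻ ω, g ω ∂P := by
        rw [lintegral_mul_const _ hρm, hρ1, one_mul]

end SubGaussian

/-- Ville's inequality for nonnegative supermartingales. -/
theorem measure_exists_lt_le {Ω : Type*} {m₀ : MeasurableSpace Ω} {P : Measure Ω}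
    {ℱ : Filtration ℕ m₀} {M : ℕ → Ω → ENNReal} (hM : ∀ n, Measurable[ℱ n] (M n))
    (hstep : ∀ n s, MeasurableSet[ℱ n] s → ∫⁻ ω in s, M (n + 1) ω ∂P ≤ ∫⁻ ω in s, M n ω ∂P)
    (h0 : ∫⁻ ω, M 0 ω ∂P ≤ 1) (c : ENNReal) :
    c * P {ω | ∃ n, c < M n ω} ≤ 1 := by
  set A : ℕ → Set Ω := fun n => ⋃ j ≤ n, {ω | c < M j ω} with hA
  have hAm : ∀ n, MeasurableSet[ℱ n] (A n) := fun n =>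
    @MeasurableSet.iUnion _ _ (ℱ n) _ _ fun j => @MeasurableSet.iUnion _ _ (ℱ n) _ _ fun hj =>
      ℱ.mono hj _ (hM j measurableSet_Ioi)
  have hAs : ∀ n, A (n + 1) = A n ∪ {ω | c < M (n + 1) ω} := fun n => by
    ext ω
    simp only [hA, Set.mem_iUnion, Set.mem_union, Set.mem_ofPred_eq, exists_prop]
    constructor
    · rintro ⟨j, hj, h⟩
      rcases Nat.le_succ_iff.1 hj with h' | rfl
      · exact Or.inl ⟨j, h', h⟩
      · exact Or.inr h
    · rintro (⟨j, hj, h⟩ | h)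
      · exact ⟨j, by omega, h⟩
      · exact ⟨n + 1, le_rfl, h⟩
  have hsplit : ∀ (n : ℕ) (S : Set Ω), MeasurableSet S →
      c * P (S ∩ {ω | c < M n ω}) + ∫⁻ ω in S \ {ω | c < M n ω}, M n ω ∂P ≤
        ∫⁻ ω in S, M n ω ∂P := by
    intro n S hS
    have hm : MeasurableSet {ω | c < M n ω} :=
      measurableSet_lt measurable_const ((hM n).mono (ℱ.le n) le_rfl)
    rw [← lintegral_inter_add_sdiff (M n) S hm]
    gcongr
    rw [← setLIntegral_const]
    exact setLIntegral_mono' (hS.inter hm) fun ω hω => hω.2.le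
  -- Invariant of the process stopped when it first exceeds `c`: paths already stopped count `c`,
  -- the others `M n`. The induction uses `hstep` on the complement of `A n`.
  have key : ∀ n, c * P (A n) + ∫⁻ ω in (A n)ᶜ, M n ω ∂P ≤ 1 := by
    intro n
    induction n with
    | zero =>
      refine le_trans (le_of_eq ?_) ((hsplit 0 Set.univ MeasurableSet.univ).trans
        (by rwa [setLIntegral_univ]))
      have : A 0 = {ω | c < M 0 ω} := by ext; simp [hA]
      rw [this, Set.univ_inter, Set.compl_eq_univ_sdiff]
    | succ n ih =>
      refine le_trans ?_ ih
      have hAc : MeasurableSet[ℱ n] (A n)ᶜ := (hAm n).compl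
      have h1 := (hsplit (n + 1) (A n)ᶜ (ℱ.le n _ hAc)).trans (hstep n _ hAc)
      have h2 : A (n + 1) = A n ∪ ((A n)ᶜ ∩ {ω | c < M (n + 1) ω}) := by
        rw [hAs, Set.union_inter_distrib_left, Set.union_compl_self, Set.univ_inter]
      have h3 : (A (n + 1))ᶜ = (A n)ᶜ \ {ω | c < M (n + 1) ω} := by
        rw [hAs, Set.compl_union]
        rfl
      rw [h3]
      calc _ ≤ c * (P (A n) + P ((A n)ᶜ ∩ {ω | c < M (n + 1) ω})) +
            ∫⁻ ω in (A n)ᶜ \ {ω | c < M (n + 1) ω}, M (n + 1) ω ∂P := by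
            gcongr
            rw [h2]
            exact measure_union_le _ _
        _ ≤ _ := by
            rw [mul_add, add_assoc]
            gcongr
  have hUn : {ω | ∃ n, c < M n ω} = ⋃ n, A n := by
    ext ω
    simp only [hA, Set.mem_iUnion, Set.mem_ofPred_eq, exists_prop]
    exact ⟨fun ⟨n, h⟩ => ⟨n, n, le_rfl, h⟩, fun ⟨_, j, _, h⟩ => ⟨j, h⟩⟩
  have hmono : Monotone A := monotone_nat_of_le_succ fun n => by
    rw [hAs]
    exact Set.subset_union_left
  rw [hUn, hmono.measure_iUnion, ENNReal.mul_iSup]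
  exact iSup_le fun n => le_self_add.trans (key n)

/-! ### Measurability of the posterior quantities. -/

section Measurability

variable {Ω : Type*} [MeasurableSpace Ω] {n : ℕ}

theorem measurable_det {A : Ω → Matrix (Fin n) (Fin n) ℝ}
    (hA : ∀ a b, Measurable fun ω => A ω a b) : Measurable fun ω => (A ω).det := by
  simp only [det_apply]
  refine Finset.measurable_fun_sum _ fun σ _ => Measurable.const_smul ?_ _
  exact Finset.measurable_fun_prod _ fun a _ => hA _ _

/-- By Cramer's rule the entries of the inverse are quotients of determinants. -/
theorem measurable_inv_apply {A : Ω → Matrix (Fin n) (Fin n) ℝ}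
    (hA : ∀ a b, Measurable fun ω => A ω a b) (a b : Fin n) :
    Measurable fun ω => (A ω)⁻¹ a b := by
  simp only [inv_def, Matrix.smul_apply, Ring.inverse_eq_inv', smul_eq_mul, adjugate_apply]
  refine (measurable_det hA).inv.mul (measurable_det fun c d => ?_)
  by_cases h : c = b
  · subst h
    simp
  · simpa [updateRow_ne h] using hA c d

theorem measurable_dotProduct_inv_mulVec {A : Ω → Matrix (Fin n) (Fin n) ℝ}
    (hA : ∀ a b, Measurable fun ω => A ω a b) {v w : Ω → Fin n → ℝ}
    (hv : ∀ a, Measurable fun ω => v ω a) (hw : ∀ a, Measurable fun ω => w ω a) :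
    Measurable fun ω => v ω ⬝ᵥ (A ω)⁻¹ *ᵥ w ω := by
  simp only [dotProduct, mulVec]
  exact Finset.measurable_fun_sum _ fun a _ => (hv a).mul <|
    Finset.measurable_fun_sum _ fun b _ => (measurable_inv_apply hA a b).mul (hw b)

variable [MeasurableSpace X] {k : X → X → ℝ} {x : Fin n → Ω → X} {u : Ω → X} {y : Fin n → Ω → ℝ}

theorem measurable_regGram_apply (hk : Measurable fun p : X × X => k p.1 p.2) (lam : ℝ)
    (hx : ∀ a, Measurable (x a)) (a b : Fin n) :
    Measurable fun ω => regGram k lam (fun a => x a ω) a b := by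
  simp only [regGram, Matrix.add_apply, gram, of_apply]
  exact (hk.comp ((hx a).prodMk (hx b))).add_const _

theorem measurable_det_regGram (hk : Measurable fun p : X × X => k p.1 p.2) (lam : ℝ)
    (hx : ∀ a, Measurable (x a)) : Measurable fun ω => (regGram k lam fun a => x a ω).det :=
  measurable_det (measurable_regGram_apply hk lam hx)

theorem measurable_fitEnergy (hk : Measurable fun p : X × X => k p.1 p.2) (lam : ℝ)
    (hx : ∀ a, Measurable (x a)) (hy : ∀ a, Measurable (y a)) :
    Measurable fun ω => fitEnergy k lam (fun a => x a ω) fun a => y a ω := by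
  have h1 := measurable_dotProduct_inv_mulVec (measurable_regGram_apply hk lam hx)
    (v := fun ω a => y a ω) (w := fun ω a => y a ω) hy hy
  have h2 : Measurable fun ω => (fun a => y a ω) ⬝ᵥ fun a => y a ω := by
    simp only [dotProduct]
    fun_prop
  exact h2.sub (h1.const_mul lam)

theorem measurable_postMean (hk : Measurable fun p : X × X => k p.1 p.2) (lam : ℝ)
    (hx : ∀ a, Measurable (x a)) (hy : ∀ a, Measurable (y a)) (hu : Measurable u) :
    Measurable fun ω => postMean k lam (fun a => x a ω) (fun a => y a ω) (u ω) :=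
  measurable_dotProduct_inv_mulVec (measurable_regGram_apply hk lam hx)
    (fun a => hk.comp (hu.prodMk (hx a))) hy

theorem measurable_postCov (hk : Measurable fun p : X × X => k p.1 p.2) (lam : ℝ)
    (hx : ∀ a, Measurable (x a)) (hu : Measurable u) :
    Measurable fun ω => postCov k lam (fun a => x a ω) (u ω) (u ω) :=
  (hk.comp (hu.prodMk hu)).sub <| measurable_dotProduct_inv_mulVec
    (measurable_regGram_apply hk lam hx) (fun a => hk.comp (hu.prodMk (hx a)))
    fun a => hk.comp (hu.prodMk (hx a))

end Measurability

/-- The supermartingale of the method of mixtures, as a function of the points and the noise. -/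
noncomputable def mixture (k : X → X → ℝ) (R : ℝ) (n : ℕ) (z : ℕ → X) (ξ : ℕ → ℝ) : ℝ :=
  (√(regGram k 1 (first n z)).det)⁻¹ *
    Real.exp (fitEnergy k 1 (first n z) (first n ξ) / (2 * R ^ 2))

/-! ### The mixture supermartingale. -/

section FeatureMap

variable {H : Type*} [NormedAddCommGroup H] [InnerProductSpace ℝ H]
  {k : X → X → ℝ} {φ : X → H} {R : ℝ}

/-- The new factor is the Gaussian mixture integral at `x = ξ n`, with `μ` and `v` the posterior
mean and variance at `z n` computed from the earlier noise, hence known before `ξ n`. -/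
theorem mixture_succ (hφ : ∀ u v, k u v = inner ℝ (φ u) (φ v)) (n : ℕ) (z : ℕ → X) (ξ : ℕ → ℝ) :
    mixture k R (n + 1) z ξ = mixture k R n z ξ *
      ((√(1 + postCov k 1 (first n z) (z n) (z n)))⁻¹ *
        Real.exp ((ξ n ^ 2 - (ξ n - postMean k 1 (first n z) (first n ξ) (z n)) ^ 2 /
          (1 + postCov k 1 (first n z) (z n) (z n))) / (2 * R ^ 2))) := by
  have hd := (regGram_posDef hφ one_pos (first n z)).det_pos
  rw [mixture, mixture, det_regGram_succ hφ one_pos, fitEnergy_succ hφ one_pos]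
  simp only [init_first, first_last, one_mul]
  rw [Real.sqrt_mul hd.le, mul_inv, add_div, Real.exp_add]
  ring

/-- A bound for the mixture is a bound for the energy of the noise. -/
theorem sqrt_fitEnergy_le_of_mixture_le (hφ : ∀ u v, k u v = inner ℝ (φ u) (φ v)) (hR : 0 < R)
    {δ B : ℝ} (hδ : 0 < δ) {n : ℕ} (hn : 1 ≤ n) {z : ℕ → X} {ξ : ℕ → ℝ}
    (h : mixture k R n z ξ ≤ δ⁻¹) :
    B + √(fitEnergy k 1 (first n z) (first n ξ)) ≤ beta k B R δ n z := by
  have hd := (regGram_posDef hφ one_pos (first n z)).det_pos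
  have h1 := (log_det_one_add_bounds hφ hn (first n z)).1
  rw [beta]
  gcongr
  -- The hypothesis becomes `exp (E / (2 R²)) ≤ √det (1 + K) / δ`. Its logarithm is bounded by the
  -- one in `beta`, whose determinant is larger.
  rw [mixture, inv_mul_le_iff₀ (Real.sqrt_pos.2 hd), ← div_eq_mul_inv] at h
  have h2 := (Real.le_log_iff_exp_le (by positivity)).2 h
  have h3 : Real.log (√(regGram k 1 (first n z)).det / δ) ≤ Real.log
      (√((1 + 2 / (n : ℝ)) • (1 : Matrix (Fin n) (Fin n) ℝ) + gram k (first n z)).det / δ) := by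
    have := Real.sqrt_pos.2 hd
    exact Real.log_le_log (by positivity) (by gcongr)
  rw [Real.sqrt_le_left (by positivity), mul_pow, Real.sq_sqrt]
  · have h4 := h2.trans h3
    rw [div_le_iff₀ (by positivity)] at h4
    linarith
  · have h5 := fitEnergy_nonneg hφ one_pos (first n z) (first n ξ)
    have : 0 ≤ fitEnergy k 1 (first n z) (first n ξ) / (2 * R ^ 2) := by positivity
    linarith

variable [MeasurableSpace X] {Ω : Type*} [MeasurableSpace Ω] {P : Measure Ω}
  [IsProbabilityMeasure P] {ℱ : Filtration ℕ (inferInstance : MeasurableSpace Ω)}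
  {z : ℕ → Ω → X} {ξ : ℕ → Ω → ℝ}

theorem measurable_mixture (hk : Measurable fun p : X × X => k p.1 p.2)
    (hz : ∀ n, Measurable[ℱ n] (z n)) (hξ : ∀ n, Measurable[ℱ (n + 1)] (ξ n)) (n : ℕ) :
    Measurable[ℱ n] fun ω => mixture k R n (fun n => z n ω) (fun n => ξ n ω) := by
  have hzn : ∀ a : Fin n, Measurable[ℱ n] (z a) := fun a =>
    (hz a).mono (ℱ.mono a.2.le) le_rfl
  have hξn : ∀ a : Fin n, Measurable[ℱ n] (ξ a) := fun a =>
    (hξ a).mono (ℱ.mono a.2) le_rfl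
  have h1 := @measurable_det_regGram X Ω (ℱ n) n _ k (fun a => z a) hk 1 hzn
  have h2 := @measurable_fitEnergy X Ω (ℱ n) n _ k (fun a => z a) (fun a => ξ a) hk 1 hzn hξn
  exact h1.sqrt.inv.mul (h2.div_const (2 * R ^ 2)).exp

theorem setLIntegral_mixture_succ_le (hφ : ∀ u v, k u v = inner ℝ (φ u) (φ v)) (hR : 0 < R)
    (hk : Measurable fun p : X × X => k p.1 p.2)
    (hz : ∀ n, Measurable[ℱ n] (z n)) (hξ : ∀ n, Measurable[ℱ (n + 1)] (ξ n))
    (hsub : ∀ n, CondSubGaussian P (ℱ n) R (ξ n)) (n : ℕ) (s : Set Ω)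
    (hs : MeasurableSet[ℱ n] s) :
    ∫⁻ ω in s, ENNReal.ofReal (mixture k R (n + 1) (fun n => z n ω) (fun n => ξ n ω)) ∂P ≤
      ∫⁻ ω in s, ENNReal.ofReal (mixture k R n (fun n => z n ω) (fun n => ξ n ω)) ∂P := by
  have hzn : ∀ a : Fin n, Measurable[ℱ n] (z a) := fun a =>
    (hz a).mono (ℱ.mono a.2.le) le_rfl
  have hξn : ∀ a : Fin n, Measurable[ℱ n] (ξ a) := fun a =>
    (hξ a).mono (ℱ.mono a.2) le_rfl
  have hμ := @measurable_postMean X Ω (ℱ n) n _ k (fun a => z a) (z n) (fun a => ξ a) hk 1 hzn hξn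
    (hz n)
  have hv := @measurable_postCov X Ω (ℱ n) n _ k (fun a => z a) (z n) hk 1 hzn (hz n)
  have hg : Measurable[ℱ n] (s.indicator fun ω =>
      ENNReal.ofReal (mixture k R n (fun n => z n ω) (fun n => ξ n ω))) :=
    (measurable_mixture hk hz hξ n).ennreal_ofReal.indicator hs
  have key := lintegral_mul_mixture_le (ℱ.le n) hR ((hξ n).mono (ℱ.le _) le_rfl) (hsub n) hμ hv
    (fun ω => postCov_self_nonneg hφ one_pos _ _) hg
  rw [← lintegral_indicator (ℱ.le n s hs), ← lintegral_indicator (ℱ.le n s hs)]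
  refine le_trans (le_of_eq (lintegral_congr fun ω => ?_)) key
  by_cases hω : ω ∈ s
  · rw [Set.indicator_of_mem hω, Set.indicator_of_mem hω, mixture_succ hφ, ENNReal.ofReal_mul
      (by rw [mixture]; positivity)]
    rfl
  · rw [Set.indicator_of_notMem hω, Set.indicator_of_notMem hω, zero_mul]

/-- With probability at least `1 - δ` the mixture never exceeds `1 / δ`. -/
theorem measureReal_mixture_le (hφ : ∀ u v, k u v = inner ℝ (φ u) (φ v)) (hR : 0 < R)
    (hk : Measurable fun p : X × X => k p.1 p.2)
    (hz : ∀ n, Measurable[ℱ n] (z n)) (hξ : ∀ n, Measurable[ℱ (n + 1)] (ξ n))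
    (hsub : ∀ n, CondSubGaussian P (ℱ n) R (ξ n)) {δ : ℝ} (hδ : 0 < δ) :
    1 - δ ≤ P.real {ω | ∀ n, mixture k R n (fun n => z n ω) (fun n => ξ n ω) ≤ δ⁻¹} := by
  have hM := measurable_mixture (R := R) hk hz hξ
  -- The process starts at 1: the empty determinant is 1 and the empty energy 0.
  have h1 := measure_exists_lt_le (P := P) (fun n => (hM n).ennreal_ofReal)
    (setLIntegral_mixture_succ_le hφ hR hk hz hξ hsub)
    (by simp [mixture, fitEnergy]) (ENNReal.ofReal δ⁻¹)
  have h2 : {ω | ∀ n, mixture k R n (fun n => z n ω) (fun n => ξ n ω) ≤ δ⁻¹} =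
      {ω | ∃ n, ENNReal.ofReal δ⁻¹ <
        ENNReal.ofReal (mixture k R n (fun n => z n ω) (fun n => ξ n ω))}ᶜ := by
    ext ω
    simp only [Set.mem_ofPred_eq, Set.mem_compl_iff, not_exists, not_lt]
    refine forall_congr' fun n => (ENNReal.ofReal_le_ofReal_iff (by positivity)).symm
  have h3 : MeasurableSet {ω | ∃ n, ENNReal.ofReal δ⁻¹ <
        ENNReal.ofReal (mixture k R n (fun n => z n ω) (fun n => ξ n ω))} := by
    rw [Set.ofPred_exists]
    exact MeasurableSet.iUnion fun n => measurableSet_lt measurable_const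
      ((hM n).mono (ℱ.le n) le_rfl).ennreal_ofReal
  rw [h2, probReal_compl_eq_one_sub h3]
  gcongr
  rw [mul_comm, ENNReal.ofReal_inv_of_pos hδ, ← div_eq_mul_inv,
    ENNReal.div_le_iff (by simpa using hδ) ENNReal.ofReal_ne_top, one_mul,
    ← ENNReal.ofReal_inv_of_pos hδ] at h1
  exact ENNReal.toReal_le_of_le_ofReal hδ.le h1

end FeatureMap

/-! ### Confidence band and accuracy of the output. -/

section Accuracy

variable {H : Type*} [NormedAddCommGroup H] [InnerProductSpace ℝ H]
  {k : X → X → ℝ} {φ : X → H} {J : H} {B R δ ε : ℝ} {lam : ℕ → ℝ} {z : ℕ → X} {ξ y : ℕ → ℝ} {i : ℕ}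

theorem abs_sub_postMean_le_beta_mul (hφ : ∀ u v, k u v = inner ℝ (φ u) (φ v)) (hR : 0 < R)
    (hδ : 0 < δ) (hJ : ‖J‖ ≤ B) (hlam : ∀ i, 1 ≤ lam i)
    (hy : ∀ n, y n = inner ℝ (φ (z n)) J + ξ n) (hξ : ∀ n, mixture k R n z ξ ≤ δ⁻¹)
    (hi : 1 ≤ i) (u : X) :
    |inner ℝ (φ u) J - postMean k (lam i) (first i z) (first i y) u| ≤
      beta k B R δ i z * postStd k (lam i) (first i z) u := by
  refine (abs_sub_postMean_noisy_le hφ (hlam i) (first i z) u J (first i y) (first i ξ)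
    fun a => hy a).trans ?_
  refine mul_le_mul_of_nonneg_right ?_ (Real.sqrt_nonneg _)
  exact (add_le_add_left hJ _).trans (sqrt_fitEnergy_le_of_mixture_le hφ hR hδ hi (hξ i))

/-- The upper confidence bound is at least `Jstar` at a maximizer of `J`, and `z i` maximizes that
bound. Conversely, at `z i` it exceeds `J` by at most the width `2 β σ ≤ ε` of the band. -/
theorem output_bounds (hφ : ∀ u v, k u v = inner ℝ (φ u) (φ v)) (hR : 0 < R)
    (hδ : 0 < δ) (hJ : ‖J‖ ≤ B) (hlam : ∀ i, 1 ≤ lam i)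
    (hy : ∀ n, y n = inner ℝ (φ (z n)) J + ξ n) (hξ : ∀ n, mixture k R n z ξ ≤ δ⁻¹)
    (hrun : IsRun k lam B R δ ε z y) {Jstar : ℝ}
    (hJstar : IsGreatest (Set.range fun u => (inner ℝ (φ u) J : ℝ)) Jstar)
    (hterm : StopsAt k lam B R δ ε i z) :
    Jstar ≤ output k lam B R δ i z y ∧ output k lam B R δ i z y ≤ Jstar + ε := by
  obtain ⟨hi, hreach, hle⟩ := hterm
  have hconf := abs_sub_postMean_le_beta_mul hφ hR hδ hJ hlam hy hξ hi
  constructor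
  · obtain ⟨u, rfl⟩ := hJstar.1
    refine le_trans ?_ (hrun i hi hreach u)
    have := (abs_le.1 (hconf u)).2
    rw [ucb]
    linarith
  · have h1 := hJstar.2 ⟨z i, rfl⟩
    have h2 := (abs_le.1 (hconf (z i))).1
    simp only at h1
    rw [regretBound] at hle
    rw [output, ucb]
    linarith

end Accuracy

end GPUCB

theorem theorem1 {l : ℕ} {Z : Set (EuclideanSpace ℝ (Fin l))}
    (hZ_compact : IsCompact Z) (hZ_convex : Convex ℝ Z)
    -- the reproducing kernel Hilbert space `H` of the kernel `k` on the decision space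
    {H : Type*} [NormedAddCommGroup H] [InnerProductSpace ℝ H] [CompleteSpace H] [RKHS ℝ H Z ℝ]
    (k : Z → Z → ℝ) (hk : ∀ u v : Z, RKHS.kernel H u v 1 = k u v)
    (hk_meas : Measurable fun p : Z × Z => k p.1 p.2)
    {B R δ ε : ℝ} (hB : 0 < B) (hR : 0 < R) (hδ : 0 < δ) (hδ1 : δ ≤ 1) (hε : 0 < ε)
    -- the objective and its maximum
    (J : H) (hJ : ‖J‖ ≤ B)
    (Jstar : ℝ) (hJstar : IsGreatest (Set.range fun u : Z => J u) Jstar)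
    -- the regularization parameters of the Gaussian process regression
    (lam : ℕ → ℝ) (Lam : ℝ) (hlam : ∀ i, 1 ≤ lam i ∧ lam i ≤ Lam)
    -- sample points, noise and measurements
    {Ω : Type*} [MeasurableSpace Ω] (P : Measure Ω) [IsProbabilityMeasure P]
    (ℱ : Filtration ℕ (inferInstance : MeasurableSpace Ω))
    (z : ℕ → Ω → Z) (ξ y : ℕ → Ω → ℝ)
    (hz : ∀ n, Measurable[ℱ n] (z n)) (hξ : ∀ n, Measurable[ℱ (n + 1)] (ξ n))
    (hξ_sub : ∀ n, GPUCB.CondSubGaussian P (ℱ n) R (ξ n))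
    (hy : ∀ n ω, y n ω = J (z n ω) + ξ n ω)
    (hrun : ∀ ω, GPUCB.IsRun k lam B R δ ε (fun n => z n ω) (fun n => y n ω)) :
    -- termination, in every run
    (∀ s : ℝ, 0 < s → GPUCB.SlowInfoGrowth k s →
      ∀ ω, ∃ i, GPUCB.StopsAt k lam B R δ ε i (fun n => z n ω)) ∧
    -- the output is an upper bound for the maximum
    1 - δ ≤ P.real {ω | ∀ i, GPUCB.StopsAt k lam B R δ ε i (fun n => z n ω) →
      Jstar ≤ GPUCB.output k lam B R δ i (fun n => z n ω) (fun n => y n ω)} ∧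
    -- the output is within the tolerance of the maximum
    1 - δ ≤ P.real {ω | ∀ i, GPUCB.StopsAt k lam B R δ ε i (fun n => z n ω) →
      |Jstar - GPUCB.output k lam B R δ i (fun n => z n ω) (fun n => y n ω)| ≤ ε} := by
  have hφ : ∀ u v : Z, k u v = inner ℝ (RKHS.kerFun H u 1) (RKHS.kerFun H v 1) := fun u v => by
    rw [← hk, real_inner_comm, ← RKHS.kernel_inner]
    simp
  have hJφ : ∀ u : Z, inner ℝ (RKHS.kerFun H u 1) J = J u := fun u => by simp
  have hgood := GPUCB.measureReal_mixture_le hφ hR hk_meas hz hξ hξ_sub hδ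
  have hbounds : ∀ ω, (∀ n, GPUCB.mixture k R n (fun n => z n ω) (fun n => ξ n ω) ≤ δ⁻¹) →
      ∀ i, GPUCB.StopsAt k lam B R δ ε i (fun n => z n ω) →
        Jstar ≤ GPUCB.output k lam B R δ i (fun n => z n ω) (fun n => y n ω) ∧
        GPUCB.output k lam B R δ i (fun n => z n ω) (fun n => y n ω) ≤ Jstar + ε :=
    fun ω hω i hi => GPUCB.output_bounds hφ hR hδ hJ (fun i => (hlam i).1)
      (fun n => by rw [hy, hJφ]) hω (hrun ω) (by simpa only [hJφ] using hJstar) hi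
  -- Both events contain the same good event, so no union bound is needed and their own
  -- measurability plays no role.
  refine ⟨fun s hs hslow ω => GPUCB.exists_stopsAt hφ hδ hδ1 hε hs hlam hslow _,
    hgood.trans (measureReal_mono fun ω hω i hi => (hbounds ω hω i hi).1),
    hgood.trans (measureReal_mono fun ω hω i hi => ?_)⟩
  obtain ⟨h1, h2⟩ := hbounds ω hω i hi
  rw [abs_le]
  constructor <;> linarith
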